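/- Let $\lambda_B,\delta,\alpha,\sigma_s,\sigma_n,P_f,P_p,b>0$ and let $M,K\ge 1$ be integers. Base stations $x_0,x_1,\dots$ form a homogeneous Poisson point process of intensity $\lambda_B$ in $\mathbb R^2$ and carry i.i.d. marks $\Phi_i$, uniform on $[0,1]$, independent of the positions. Base station $i$ is active if $\Phi_i>\Phi_j$ for every $j\ne i$ with $|x_j-x_i|\le\delta$; the active base stations form the Matérn type II hard-core process with minimum distance $\delta$. User $k$ of cell $i$ is located at $x_i+x_{\rm int}$ for a fixed vector $x_{\rm int}\neq 0$. The link from base station $u$ to this user has large scale fading coefficient $\beta_{uki}=\omega_{uki}\,|x_u-x_i-x_{\rm int}|^{-\alpha}$ (so that $\beta_{iki}=\omega_{iki}|x_{\rm int}|^{-\alpha}$), where the shadowings $\omega_{uki}=e^{s_{uki}/b}$, $s_{uki}\sim N(0,\sigma_s^2)$, are, for each $k$ and $i$, i.i.d. over $u$ and independent of the positions and marks. The achievable rate of user $k$ in an active cell $i$ is $$R_{ik}=\log_2\Bigl(1+\frac{M^2P_fP_p\beta_{iki}^2}{I_{ik}+\sigma_n^2}\Bigr),\qquad I_{ik}=M^2P_fP_p\sum_{u\ne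 i,\ u\text{ active}}\beta_{uki}^2 ,$$ and its average over a Borel set $S\subset\mathbb R^2$ with $0<|S|<\infty$ is $$R_{k,{\rm avg}}(S)=\frac{\mathbb E\bigl[\sum_{i\text{ active},\,x_i\in S}R_{ik}\bigr]}{\mathbb E\bigl[\#\{i\text{ active}:x_i\in S\}\bigr]}.$$ Let $$\zeta^{(1)}=\frac{1-e^{-\lambda_B\pi\delta^2}}{\pi\delta^2},\qquad \zeta^{(2)}(r)=\frac{2V_\delta(r)(1-e^{-\lambda_B\pi\delta^2})-2\pi\delta^2(1-e^{-\lambda_BV_\delta(r)})}{\pi\delta^2V_\delta(r)(V_\delta(r)-\pi\delta^2)}\ \ (r>\delta),\qquad \zeta^{(2)}(r)=0\ \ (r\le\delta)$$ be the first and second moment densities of the hard-core process, where $V_\delta(r)=2\pi\delta^2-2\delta^2\arccos\frac{r}{2\delta}+r\sqrt{\delta^2-r^2/4}$ for $0<r<2\delta$ and $V_\delta(r)=2\pi\delta^2$ for $r\ge2\delta$. For $m>0$ put $$L(m)=\int_0^\infty\log_2\!\left(1+\frac{M^2P_fP_p\,\omega^2\,\zeta^{(1)}m^{-1}|x_{\rm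 int}|^{-2\alpha}}{M^2P_fP_p\int_{\mathbb R^2}\frac{\zeta^{(2)}(|y|)}{|y+x_{\rm int}|^{2\alpha}}\,dy+\zeta^{(1)}m^{-1}\sigma_n^2}\right)\frac{b}{\omega\sqrt{2\pi}\,\sigma_s}\exp\!\Bigl(-\frac{b^2\ln^2\omega}{2\sigma_s^2}\Bigr)d\omega ,$$ where the fraction is read as $0$ if the integral over $\mathbb R^2$ is infinite. Then, for every such $S$ (hence also in the limit $S\to\mathbb R^2$), $$R_{k,{\rm avg}}(S)\ \ge\ L\bigl(e^{2\sigma_s^2/b^2}\bigr),$$ where $e^{2\sigma_s^2/b^2}=\mathbb E[\omega_{uki}^2]$. Moreover, if $b\ge1$, then also $R_{k,{\rm avg}}(S)\ge L(e^{2\sigma_s^2})$. -/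

import Mathlib

open MeasureTheory ProbabilityTheory Set
open scoped ENNReal NNReal

noncomputable section

/-- The Euclidean plane. -/
abbrev Plane : Type := EuclideanSpace ℝ (Fin 2)

variable {Ω : Type*} [MeasurableSpace Ω]

/-- The number of points of the random sequence `x` that lie in `B`. -/
def pointCount (x : ℕ → Ω → Plane) (B : Set Plane) (w : Ω) : ℕ∞ :=
  {i : ℕ | x i w ∈ B}.encard

/-- The random points `x 0, x 1, …` form a homogeneous Poisson point process of intensity `lam`:
the number of points in a Borel set of finite area is Poisson distributed with mean `lam` times
the area, and the numbers of points in pairwise disjoint Borel sets are independent. -/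
structure IsPoissonProcess (x : ℕ → Ω → Plane) (lam : ℝ) (P : Measure Ω) : Prop where
  measurable : ∀ i, Measurable (x i)
  count_law : ∀ B : Set Plane, MeasurableSet B → volume B ≠ ∞ → ∀ n : ℕ,
    P {w | pointCount x B w = n} =
      ENNReal.ofReal (Real.exp (-(lam * volume.real B)) * (lam * volume.real B) ^ n / n.factorial)
  count_indep : ∀ (m : ℕ) (B : Fin m → Set Plane), (∀ j, MeasurableSet (B j)) →
    (∀ j, volume (B j) ≠ ∞) → Pairwise (fun j l => Disjoint (B j) (B l)) →
    iIndepFun (fun j => pointCount x (B j)) P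

/-- The random ingredients of the network: `x i` is the position of the `i`-th base station,
`Phi i` is its traffic mark, and `s u k i` is the Gaussian exponent of the shadowing on the link
from base station `u` to the `k`-th user of cell `i`. The base stations form a Poisson process,
the marks are i.i.d. uniform on `[0,1]` and independent of the positions, and the shadowing
exponents on the links to any one user are i.i.d. `N(0, σs²)`, independent of the positions and
marks. -/
structure IsNetwork {K : ℕ} (x : ℕ → Ω → Plane) (Phi : ℕ → Ω → ℝ)
    (s : ℕ → Fin K → ℕ → Ω → ℝ) (lam sigmaS : ℝ) (P : Measure Ω) : Prop where
  poisson : IsPoissonProcess x lam P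
  mark_measurable : ∀ i, Measurable (Phi i)
  mark_law : ∀ i, P.map (Phi i) = volume.restrict (Icc (0 : ℝ) 1)
  mark_indep : iIndepFun Phi P
  mark_indep_points : IndepFun (fun w i => x i w) (fun w i => Phi i w) P
  shadow_measurable : ∀ u k i, Measurable (s u k i)
  shadow_law : ∀ u k i, P.map (s u k i) = gaussianReal 0 (Real.toNNReal (sigmaS ^ 2))
  shadow_iIndep : ∀ k i, iIndepFun (fun u => s u k i) P
  shadow_indep : ∀ k i,
    IndepFun (fun w => ((fun j => x j w), (fun j => Phi j w))) (fun w u => s u k i w) P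

/-- Dependent thinning: base station `i` is active if its mark is larger than the marks of all
other base stations in the disk of radius `δ` around it. The active base stations form the
Matérn type II hard-core process. -/
def IsActive (x : ℕ → Ω → Plane) (Phi : ℕ → Ω → ℝ) (δ : ℝ) (w : Ω) (i : ℕ) : Prop :=
  ∀ j, j ≠ i → dist (x j w) (x i w) ≤ δ → Phi j w < Phi i w

/-- The deterministic parameters: number of antennas `M`, signal power `Pf`, pilot power `Pp`,
path loss exponent `α`, noise power `sigmaN ^ 2`, base station intensity `lam`, minimum distance `δ`,
shadowing deviation `sigmaS` and shadowing scale `b` (the shadowing is `exp (s / b)`). -/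
structure Params where
  M : ℕ
  Pf : ℝ
  Pp : ℝ
  α : ℝ
  sigmaN : ℝ
  lam : ℝ
  δ : ℝ
  sigmaS : ℝ
  b : ℝ

/-- All parameters are positive. -/
structure Params.Positive (p : Params) : Prop where
  M : 0 < p.M
  Pf : 0 < p.Pf
  Pp : 0 < p.Pp
  α : 0 < p.α
  sigmaN : 0 < p.sigmaN
  lam : 0 < p.lam
  δ : 0 < p.δ
  sigmaS : 0 < p.sigmaS
  b : 0 < p.b

namespace Params

variable (p : Params)

/-- The power factor `M² Pf Pp`. -/
def gain : ℝ := (p.M : ℝ) ^ 2 * p.Pf * p.Pp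

/-- The large scale fading coefficient `exp (t / b) / r ^ α` of a link of length `r` with
shadowing exponent `t`. -/
def fading (t r : ℝ) : ℝ≥0∞ :=
  ENNReal.ofReal (Real.exp (t / p.b)) / ENNReal.ofReal r ^ p.α

variable {K : ℕ} (x : ℕ → Ω → Plane) (Phi : ℕ → Ω → ℝ) (s : ℕ → Fin K → ℕ → Ω → ℝ)

/-- The signal power received by user `k` of cell `i`, which sits at `x i + v`. -/
def signal (v : Plane) (k : Fin K) (i : ℕ) (w : Ω) : ℝ≥0∞ :=
  ENNReal.ofReal p.gain * p.fading (s i k i w) ‖v‖ ^ 2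

/-- The interference power at user `k` of cell `i`, which sits at `x i + v`: the sum over the
active base stations `u ≠ i`. -/
def interference (v : Plane) (k : Fin K) (i : ℕ) (w : Ω) : ℝ≥0∞ :=
  ENNReal.ofReal p.gain *
    ∑' u : {u : ℕ // u ≠ i ∧ IsActive x Phi p.δ w u},
      p.fading (s u k i w) ‖x u w - x i w - v‖ ^ 2

/-- The achievable rate of user `k` of cell `i`. -/
def rate (v : Plane) (k : Fin K) (i : ℕ) (w : Ω) : ℝ :=
  Real.logb 2 (1 + (p.signal s v k i w /
    (p.interference x Phi s v k i w + ENNReal.ofReal (p.sigmaN ^ 2))).toReal)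

/-- The cells whose (active) base station lies in `S`. -/
def activeIn (S : Set Plane) (w : Ω) : Set ℕ :=
  {i | x i w ∈ S ∧ IsActive x Phi p.δ w i}

/-- The average achievable rate of user `k` of a cell: expected sum of the rates over the cells
with active base station in `S`, divided by the expected number of these cells. -/
def avgRate (P : Measure Ω) (v : Plane) (k : Fin K) (S : Set Plane) : ℝ≥0∞ :=
  (∫⁻ w, ∑' i : p.activeIn x Phi S w, ENNReal.ofReal (p.rate x Phi s v k i w) ∂P) /
    (∫⁻ w, ((p.activeIn x Phi S w).encard : ℝ≥0∞) ∂P)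

/-- First moment density of the hard-core process. -/
def zeta1 : ℝ := (1 - Real.exp (-(p.lam * Real.pi * p.δ ^ 2))) / (Real.pi * p.δ ^ 2)

/-- Area of the union of two disks of radius `δ` with centres at distance `r > 0`. -/
def unionArea (r : ℝ) : ℝ :=
  if r < 2 * p.δ then
    2 * Real.pi * p.δ ^ 2 - 2 * p.δ ^ 2 * Real.arccos (r / (2 * p.δ))
      + r * Real.sqrt (p.δ ^ 2 - r ^ 2 / 4)
  else 2 * Real.pi * p.δ ^ 2

/-- The probability that two base stations at distance `r` are both retained. -/
def retention (r : ℝ) : ℝ :=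
  if p.δ < r then
    (2 * p.unionArea r * (1 - Real.exp (-(p.lam * Real.pi * p.δ ^ 2)))
        - 2 * Real.pi * p.δ ^ 2 * (1 - Real.exp (-(p.lam * p.unionArea r)))) /
      (p.lam ^ 2 * Real.pi * p.δ ^ 2 * p.unionArea r * (p.unionArea r - Real.pi * p.δ ^ 2))
  else 0

/-- Second moment density of the hard-core process at distance `r`. -/
def zeta2 (r : ℝ) : ℝ := p.lam ^ 2 * p.retention r

/-- The integral `∫ ζ⁽²⁾(|y|) / |y + v| ^ (2α) dy` over the plane; it may be infinite. -/
def pairIntegral (v : Plane) : ℝ≥0∞ :=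
  ∫⁻ y : Plane, ENNReal.ofReal (p.zeta2 ‖y‖) / ENNReal.ofReal ‖y + v‖ ^ (2 * p.α)

/-- The lognormal density of `exp (s / b)` with `s ∼ N(0, σs²)`. -/
def shadowDensity (ω : ℝ) : ℝ :=
  p.b / (ω * Real.sqrt (2 * Real.pi) * p.sigmaS) *
    Real.exp (-(p.b ^ 2 * Real.log ω ^ 2 / (2 * p.sigmaS ^ 2)))

/-- The explicit lower bound, with the value `m` for the second moment of the shadowing. Where the
interference integral is infinite, the quotient inside the logarithm is zero. -/
def rateBound (m : ℝ) (v : Plane) : ℝ≥0∞ :=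
  ∫⁻ ω in Ioi (0 : ℝ),
    ENNReal.ofReal (Real.logb 2 (1 +
      (ENNReal.ofReal (p.gain * ω ^ 2 * p.zeta1 * m⁻¹ * ‖v‖ ^ (-(2 * p.α))) /
        (ENNReal.ofReal p.gain * p.pairIntegral v
          + ENNReal.ofReal (p.zeta1 * m⁻¹ * p.sigmaN ^ 2))).toReal)
      * p.shadowDensity ω)

end Params

end

/-! ### Generating functions of Poisson counts. -/

section

variable {Ω : Type*} [MeasurableSpace Ω]

/-! The rate is a convex decreasing function of the interference, so it lies above its tangent at
any deterministic level. The level chosen is `J` = gain · m · ∫ζ⁽²⁾(|y|)/|y+v|^{2α} dy / ζ⁽¹⁾, the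
interference level appearing in the bound. Its slope depends on the shadowing of the user's own
link. Add the tangent inequality over the active cells in S and take expectations. The shadowings
are independent of the geometry, and the own link is independent of the interfering ones. Hence the
constant terms give N times the bound, N being the mean number of active cells, and it remains to
see that the slope-weighted mean interference is at most N · C · J, with C the mean slope. This
needs only two one-sided moment estimates for the hard-core process: N ≥ ζ⁽¹⁾|S| (`mean_active_ge`),
and second moment measure at most the one with density ζ⁽²⁾ (`lintegral_active_pair_le`). The
averaging is carried out in `rateBound_le_avgRate`.

The moment estimates use only the Poisson law and the independence of counts in disjoint sets. The
obstacle is that the disk in which a station competes moves with the station. For a station in a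
cell of radius ε around c, the moving disk of radius δ lies between the fixed disks of radius δ - ε
and δ + ε around c. The larger disk bounds activity from below, the smaller from above. For fixed
disks, condition on the positions: the probability that given points carry the largest marks is an
integral of powers of uniform variables, and averaging over the counts turns these powers into
generating functions (`tsum_measure_dominates`, `tsum_measure_two_dominate`). Letting ε → 0 over a
partition into small cells yields ζ⁽¹⁾ and ζ⁽²⁾. The explicit form of ζ⁽²⁾ comes from
`pairKernel_eq` and the area of two overlapping disks.

For b ≥ 1 the second bound is weaker, because the bound decreases in m. -/

theorem Real.hasSum_pow_div_factorial (t : ℝ) : HasSum (fun n : ℕ => t ^ n / n.factorial) (Real.exp t) := by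
  rw [Real.exp_eq_exp_ℝ]
  exact NormedSpace.expSeries_div_hasSum_exp t

/-- Probability generating function of the Poisson distribution. -/
theorem tsum_pow_mul_poisson {t c : ℝ} (ht : 0 ≤ t) (hc : 0 ≤ c) :
    ∑' n : ℕ, ENNReal.ofReal t ^ n * ENNReal.ofReal (Real.exp (-c) * c ^ n / n.factorial) =
      ENNReal.ofReal (Real.exp (-(c * (1 - t)))) := by
  have h := (Real.hasSum_pow_div_factorial (c * t)).mul_left (Real.exp (-c))
  have e : Real.exp (-c) * Real.exp (c * t) = Real.exp (-(c * (1 - t))) := by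
    rw [← Real.exp_add]; ring_nf
  rw [e] at h
  rw [← h.tsum_eq, ENNReal.ofReal_tsum_of_nonneg (fun n => by positivity) h.summable]
  refine tsum_congr fun n => ?_
  rw [← ENNReal.ofReal_pow ht, ← ENNReal.ofReal_mul (by positivity)]
  congr 1
  rw [mul_pow]; ring

/-- Derivative of the generating function in `t`: the factor `n` chooses a distinguished point and
`n - 1` counts the others. Truncated subtraction at `n = 0` is harmless, as that term is zero;
shifting the index reduces to the generating function itself. -/
theorem tsum_nat_mul_pow_mul_poisson {t c : ℝ} (ht : 0 ≤ t) (hc : 0 ≤ c) :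
    ∑' n : ℕ, ((n : ℝ≥0∞) * ENNReal.ofReal t ^ (n - 1)) *
        ENNReal.ofReal (Real.exp (-c) * c ^ n / n.factorial) =
      ENNReal.ofReal c * ENNReal.ofReal (Real.exp (-(c * (1 - t)))) := by
  rw [tsum_eq_zero_add' ENNReal.summable, ← tsum_pow_mul_poisson ht hc, ← ENNReal.tsum_mul_left]
  simp only [Nat.cast_zero, zero_mul, zero_add]
  refine tsum_congr fun n => ?_
  rw [Nat.add_sub_cancel, mul_left_comm, mul_assoc, mul_left_comm (((n + 1 : ℕ) : ℝ≥0∞))]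
  congr 1
  rw [← ENNReal.ofReal_natCast, ← ENNReal.ofReal_mul (by positivity), ← ENNReal.ofReal_mul hc]
  congr 1
  rw [Nat.factorial_succ]
  push_cast
  field_simp
  ring

/-- The number of points in `B` as a natural number. -/
noncomputable def pointNum (x : ℕ → Ω → Plane) (B : Set Plane) (w : Ω) : ℕ :=
  (pointCount x B w).toNat

namespace IsPoissonProcess

variable {x : ℕ → Ω → Plane} {lam : ℝ} {P : Measure Ω}

theorem measurable_pointCount (h : IsPoissonProcess x lam P) {B : Set Plane}
    (hB : MeasurableSet B) : Measurable (pointCount x B) := by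
  refine measurable_encard.comp ?_
  rw [measurable_set_iff]
  intro i
  exact measurableSet_setOfPred.1 ((h.measurable i) hB)

theorem measurable_pointNum (h : IsPoissonProcess x lam P) {B : Set Plane}
    (hB : MeasurableSet B) : Measurable (pointNum x B) :=
  (Measurable.of_discrete (f := ENat.toNat)).comp (h.measurable_pointCount hB)

/-- The Poisson weights already sum to one, which leaves no mass for an infinite count; hence
`pointNum` loses nothing almost surely. -/
theorem ae_pointCount_ne_top [IsProbabilityMeasure P] (h : IsPoissonProcess x lam P) (hl : 0 ≤ lam) {B : Set Plane}
    (hB : MeasurableSet B) (hv : volume B ≠ ∞) : ∀ᵐ w ∂P, pointCount x B w ≠ ⊤ := by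
  have hm (n : ℕ) : MeasurableSet {w | pointCount x B w = n} :=
    h.measurable_pointCount hB (measurableSet_singleton _)
  have key : P (⋃ n : ℕ, {w | pointCount x B w = n}) = 1 := by
    rw [measure_iUnion _ hm]
    · simp_rw [h.count_law B hB hv]
      have := tsum_pow_mul_poisson (t := 1) (c := lam * volume.real B) zero_le_one (by positivity)
      simpa using this
    · intro n m hnm
      refine Set.disjoint_left.2 fun w h1 h2 => hnm ?_
      simp only [mem_ofPred_eq] at h1 h2
      exact_mod_cast h1.symm.trans h2
  have := (prob_compl_eq_zero_iff (MeasurableSet.iUnion hm)).2 key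
  filter_upwards [measure_eq_zero_iff_ae_notMem.1 this] with w hw htop
  simp [htop] at hw

theorem ae_finite [IsProbabilityMeasure P] (h : IsPoissonProcess x lam P) (hl : 0 ≤ lam) {B : Set Plane}
    (hB : MeasurableSet B) (hv : volume B ≠ ∞) : ∀ᵐ w ∂P, {i | x i w ∈ B}.Finite := by
  filter_upwards [h.ae_pointCount_ne_top hl hB hv] with w hw
  exact Set.encard_ne_top_iff.1 hw

theorem lintegral_pointNum [IsProbabilityMeasure P] (h : IsPoissonProcess x lam P) (hl : 0 ≤ lam) {B : Set Plane}
    (hB : MeasurableSet B) (hv : volume B ≠ ∞) (F : ℕ → ℝ≥0∞) :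
    ∫⁻ w, F (pointNum x B w) ∂P = ∑' n : ℕ, F n * ENNReal.ofReal
      (Real.exp (-(lam * volume.real B)) * (lam * volume.real B) ^ n / n.factorial) := by
  rw [← lintegral_map (f := F) (g := pointNum x B) (by fun_prop) (h.measurable_pointNum hB),
    lintegral_countable']
  refine tsum_congr fun n => ?_
  rw [Measure.map_apply (h.measurable_pointNum hB) (measurableSet_singleton _),
    ← h.count_law B hB hv]
  congr 1
  refine measure_congr ?_
  filter_upwards [h.ae_pointCount_ne_top hl hB hv] with w hw
  refine propext ?_
  change pointNum x B w = n ↔ pointCount x B w = n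
  rw [pointNum]
  conv_rhs => rw [← ENat.natCast_toNat hw]
  norm_cast

theorem lintegral_pow_pointNum [IsProbabilityMeasure P] (h : IsPoissonProcess x lam P) (hl : 0 ≤ lam) {B : Set Plane}
    (hB : MeasurableSet B) (hv : volume B ≠ ∞) {t : ℝ} (ht : 0 ≤ t) :
    ∫⁻ w, ENNReal.ofReal t ^ pointNum x B w ∂P =
      ENNReal.ofReal (Real.exp (-(lam * volume.real B * (1 - t)))) := by
  rw [h.lintegral_pointNum hl hB hv (fun n => ENNReal.ofReal t ^ n),
    tsum_pow_mul_poisson ht (by positivity)]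

theorem lintegral_mul_pow_pointNum [IsProbabilityMeasure P] (h : IsPoissonProcess x lam P) (hl : 0 ≤ lam)
    {B : Set Plane} (hB : MeasurableSet B) (hv : volume B ≠ ∞) {t : ℝ} (ht : 0 ≤ t) :
    ∫⁻ w, (pointNum x B w : ℝ≥0∞) * ENNReal.ofReal t ^ (pointNum x B w - 1) ∂P =
      ENNReal.ofReal (lam * volume.real B) *
        ENNReal.ofReal (Real.exp (-(lam * volume.real B * (1 - t)))) := by
  rw [h.lintegral_pointNum hl hB hv (fun n => (n : ℝ≥0∞) * ENNReal.ofReal t ^ (n - 1)),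
    tsum_nat_mul_pow_mul_poisson ht (by positivity)]

theorem lintegral_prod_pointNum [IsProbabilityMeasure P] (h : IsPoissonProcess x lam P)
    {m : ℕ} (B : Fin m → Set Plane) (hB : ∀ j, MeasurableSet (B j)) (hv : ∀ j, volume (B j) ≠ ∞)
    (hd : Pairwise (fun j l => Disjoint (B j) (B l))) (F : Fin m → ℕ → ℝ≥0∞) :
    ∫⁻ w, ∏ j, F j (pointNum x (B j) w) ∂P = ∏ j, ∫⁻ w, F j (pointNum x (B j) w) ∂P := by
  refine lintegral_prod_eq_prod_lintegral_of_indepFun _ (fun j w => F j (pointNum x (B j) w)) ?_ ?_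
  · exact (h.count_indep m B hB hv hd).comp (fun j n => F j n.toNat)
      (fun j => Measurable.of_discrete)
  · intro j
    exact (Measurable.of_discrete (f := F j)).comp (h.measurable_pointNum (hB j))

end IsPoissonProcess

end

/-! ### Largest marks among independent uniform marks. -/

section

variable {Ω : Type*} [MeasurableSpace Ω]

theorem volume_restrict_Icc_Iio {a : ℝ} (ha : a ≤ 1) :
    (volume.restrict (Icc (0 : ℝ) 1)) (Iio a) = ENNReal.ofReal a := by
  rw [Measure.restrict_apply measurableSet_Iio]
  have : Iio a ∩ Icc 0 1 = Ico 0 a := by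
    ext y
    simp only [mem_inter_iff, mem_Iio, mem_Icc, mem_Ico]
    constructor
    · rintro ⟨h1, h2, h3⟩; exact ⟨h2, h1⟩
    · rintro ⟨h1, h2⟩; exact ⟨h2, h1, by linarith⟩
  rw [this, Real.volume_Ico, sub_zero]

/-- Independent uniform marks `Phi j`. -/
structure IsUniformMarks (Phi : ℕ → Ω → ℝ) (P : Measure Ω) : Prop where
  measurable : ∀ i, Measurable (Phi i)
  law : ∀ i, P.map (Phi i) = volume.restrict (Icc (0 : ℝ) 1)
  indep : iIndepFun Phi P

namespace IsUniformMarks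

variable {Phi : ℕ → Ω → ℝ} {P : Measure Ω}

/-- Fubini in the marks of `i` and `u`: once these are frozen, the other marks are independent
uniforms, each below its own threshold. -/
theorem measure_forall_lt [IsProbabilityMeasure P] (h : IsUniformMarks Phi P) {i u : ℕ} (hiu : i ≠ u) (T : Finset ℕ)
    (hi : i ∉ T) (hu : u ∉ T) (c : ℕ → ℝ × ℝ → ℝ) (hc : ∀ j, Measurable (c j)) :
    P {w | ∀ j ∈ T, Phi j w < c j (Phi i w, Phi u w)} =
      ∫⁻ s in Icc (0 : ℝ) 1, ∫⁻ t in Icc (0 : ℝ) 1,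
        ∏ j ∈ T, (volume.restrict (Icc (0 : ℝ) 1)) (Iio (c j (s, t))) := by
  have hQm : Measurable (fun w => (Phi i w, Phi u w)) := (h.measurable i).prodMk (h.measurable u)
  have hRm : Measurable (fun w (j : T) => Phi j w) :=
    measurable_pi_lambda _ fun j => h.measurable j
  have hQ : P.map (fun w => (Phi i w, Phi u w)) =
      (volume.restrict (Icc (0 : ℝ) 1)).prod (volume.restrict (Icc (0 : ℝ) 1)) := by
    have := (indepFun_iff_map_prod_eq_prod_map_map (h.measurable i).aemeasurable
      (h.measurable u).aemeasurable).1 (h.indep.indepFun hiu)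
    rw [this, h.law, h.law]
  have hind : IndepFun (fun w => (Phi i w, Phi u w)) (fun w (j : T) => Phi j w) P := by
    have hdis : Disjoint ({i, u} : Finset ℕ) T := by
      rw [Finset.disjoint_left]
      intro a ha
      simp only [Finset.mem_insert, Finset.mem_singleton] at ha
      rcases ha with rfl | rfl <;> assumption
    have := h.indep.indepFun_finset {i, u} T hdis h.measurable
    exact this.comp (φ := fun q : (({i, u} : Finset ℕ) → ℝ) => (q ⟨i, by simp⟩, q ⟨u, by simp⟩))
      (ψ := id) (by fun_prop) measurable_id
  have hE : MeasurableSet {q : (ℝ × ℝ) × (T → ℝ) | ∀ j : T, q.2 j < c j q.1} := by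
    rw [Set.ofPred_forall]
    refine MeasurableSet.iInter fun j => measurableSet_lt (by fun_prop) ((hc j).comp measurable_fst)
  have h1 : P {w | ∀ j ∈ T, Phi j w < c j (Phi i w, Phi u w)} =
      P.map (fun w => ((Phi i w, Phi u w), fun j : T => Phi j w))
        {q : (ℝ × ℝ) × (T → ℝ) | ∀ j : T, q.2 j < c j q.1} := by
    rw [Measure.map_apply (hQm.prodMk hRm) hE]
    congr 1
    ext w
    simp
  have h2 (q : ℝ × ℝ) : P.map (fun w (j : T) => Phi j w) {r | ∀ j : T, r j < c j q} =
      ∏ j ∈ T, (volume.restrict (Icc (0 : ℝ) 1)) (Iio (c j q)) := by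
    rw [Measure.map_apply hRm]
    · have := h.indep.measure_inter_preimage_eq_mul T (sets := fun j => Iio (c j q))
        (fun j _ => measurableSet_Iio)
      have hmap (j : ℕ) : (volume.restrict (Icc (0 : ℝ) 1)) (Iio (c j q)) =
          P (Phi j ⁻¹' Iio (c j q)) := by
        rw [← h.law j, Measure.map_apply (h.measurable j) measurableSet_Iio]
      simp_rw [hmap]
      rw [← this]
      congr 1
      ext w
      simp
    · rw [Set.ofPred_forall]
      exact MeasurableSet.iInter fun j => measurableSet_lt (by fun_prop) measurable_const
  rw [h1, (indepFun_iff_map_prod_eq_prod_map_map hQm.aemeasurable hRm.aemeasurable).1 hind]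
  have := Measure.isProbabilityMeasure_map (μ := P) hRm.aemeasurable
  rw [Measure.prod_apply hE, hQ, lintegral_prod]
  · refine lintegral_congr fun s => lintegral_congr fun t => ?_
    exact h2 (s, t)
  · exact (measurable_measure_prodMk_left hE).aemeasurable

theorem measure_two_maxima [IsProbabilityMeasure P] (h : IsUniformMarks Phi P) {i u : ℕ} (hiu : i ≠ u) (J J' : Finset ℕ)
    (hi : i ∉ J ∪ J') (hu : u ∉ J ∪ J') :
    P {w | (∀ j ∈ J, Phi j w < Phi i w) ∧ ∀ j ∈ J', Phi j w < Phi u w} =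
      ∫⁻ s in Icc (0 : ℝ) 1, ∫⁻ t in Icc (0 : ℝ) 1,
        ENNReal.ofReal s ^ (J \ J').card * ENNReal.ofReal t ^ (J' \ J).card *
          ENNReal.ofReal (min s t) ^ (J ∩ J').card := by
  -- A competitor of both `i` and `u` must stay below the smaller of the two marks, a competitor of
  -- one of them only below that one.
  let c : ℕ → ℝ × ℝ → ℝ := fun j q => if j ∈ J then (if j ∈ J' then min q.1 q.2 else q.1) else q.2
  have hc (j : ℕ) : Measurable (c j) := by
    by_cases h1 : j ∈ J <;> by_cases h2 : j ∈ J' <;> simp only [c, h1, h2, if_true, if_false] <;>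
      fun_prop
  have key := h.measure_forall_lt hiu (J ∪ J') hi hu c hc
  have e : {w | (∀ j ∈ J, Phi j w < Phi i w) ∧ ∀ j ∈ J', Phi j w < Phi u w} =
      {w | ∀ j ∈ J ∪ J', Phi j w < c j (Phi i w, Phi u w)} := by
    ext w
    simp only [mem_ofPred_eq, Finset.mem_union, c]
    constructor
    · rintro ⟨h1, h2⟩ j hj
      by_cases h3 : j ∈ J <;> by_cases h4 : j ∈ J' <;> simp_all
    · intro H
      refine ⟨fun j hj => ?_, fun j hj => ?_⟩
      · have := H j (Or.inl hj)
        by_cases h4 : j ∈ J' <;> simp_all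
      · have := H j (Or.inr hj)
        by_cases h4 : j ∈ J <;> simp_all
  rw [e, key]
  refine setLIntegral_congr_fun measurableSet_Icc fun s hs =>
    setLIntegral_congr_fun measurableSet_Icc fun t ht => ?_
  have hd1 : Disjoint (J \ J') (J' \ J) := by
    rw [Finset.disjoint_left]; intro a; simp; tauto
  have hd2 : Disjoint ((J \ J') ∪ (J' \ J)) (J ∩ J') := by
    rw [Finset.disjoint_left]; intro a; simp; tauto
  have hU : J ∪ J' = ((J \ J') ∪ (J' \ J)) ∪ (J ∩ J') := by
    ext a; simp; tauto
  change ∏ j ∈ J ∪ J', _ = _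
  rw [hU, Finset.prod_union hd2, Finset.prod_union hd1]
  congr 1
  · congr 1
    · refine Finset.prod_eq_pow_card fun j hj => ?_
      simp only [Finset.mem_sdiff] at hj
      simp only [c, hj.1, hj.2, if_true, if_false]
      exact volume_restrict_Icc_Iio hs.2
    · refine Finset.prod_eq_pow_card fun j hj => ?_
      simp only [Finset.mem_sdiff] at hj
      simp only [c, hj.2, if_false]
      exact volume_restrict_Icc_Iio ht.2
  · refine Finset.prod_eq_pow_card fun j hj => ?_
    simp only [Finset.mem_inter] at hj
    simp only [c, hj.1, hj.2, if_true]
    exact volume_restrict_Icc_Iio (min_le_of_left_le hs.2)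

theorem measure_maximum [IsProbabilityMeasure P] (h : IsUniformMarks Phi P) {i : ℕ} (J : Finset ℕ) (hi : i ∉ J) :
    P {w | ∀ j ∈ J, Phi j w < Phi i w} =
      ∫⁻ s in Icc (0 : ℝ) 1, ENNReal.ofReal s ^ J.card := by
  -- A dummy second index without competitors; its integral contributes the factor 1.
  obtain ⟨u, hu⟩ := Infinite.exists_notMem_finset (insert i J)
  simp only [Finset.mem_insert, not_or] at hu
  have := h.measure_two_maxima (Ne.symm hu.1) J ∅ (by simpa using hi) (by simpa using hu.2)
  simpa using this

end IsUniformMarks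

end

/-! ### First moments for competition in a fixed region. -/

section

theorem pointNum_eq_card {Ω : Type*} {x : ℕ → Ω → Plane} {B : Set Plane} {w : Ω} {J : Finset ℕ}
    (hJ : ∀ j, j ∈ J ↔ x j w ∈ B) : pointNum x B w = J.card := by
  have : {i | x i w ∈ B} = (J : Set ℕ) := by ext j; simp [hJ]
  rw [pointNum, pointCount, this, Set.encard_coe_eq_coe_finsetCard, ENat.toNat_natCast]

theorem tsum_ite_mem_eq_pointNum {Ω : Type*} {x : ℕ → Ω → Plane} {A : Set Plane} {w : Ω} [DecidablePred (· ∈ A)]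
    (hA : {i | x i w ∈ A}.Finite) (c : ℝ≥0∞) :
    ∑' i, (if x i w ∈ A then c else 0) = pointNum x A w * c := by
  have h1 : ∀ j, j ∈ hA.toFinset ↔ x j w ∈ A := fun j => by simp
  rw [pointNum_eq_card h1, tsum_eq_sum (s := hA.toFinset)]
  · rw [← nsmul_eq_mul, ← Finset.sum_const]
    exact Finset.sum_congr rfl fun i hi => if_pos ((h1 i).1 hi)
  · intro i hi
    exact if_neg fun h => hi ((h1 i).2 h)

variable {Ω : Type*} [MeasurableSpace Ω]

/-- Points of a Poisson process with independent uniform marks. -/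
structure IsMarkedPoisson (x : ℕ → Ω → Plane) (Phi : ℕ → Ω → ℝ) (lam : ℝ) (P : Measure Ω) : Prop where
  poisson : IsPoissonProcess x lam P
  marks : IsUniformMarks Phi P
  indep : IndepFun (fun w i => x i w) (fun w i => Phi i w) P

namespace IsMarkedPoisson

variable {x : ℕ → Ω → Plane} {Phi : ℕ → Ω → ℝ} {lam : ℝ} {P : Measure Ω}

theorem measurable_points (h : IsMarkedPoisson x Phi lam P) : Measurable (fun w i => x i w) :=
  measurable_pi_lambda _ h.poisson.measurable

theorem measurable_marks (h : IsMarkedPoisson x Phi lam P) : Measurable (fun w i => Phi i w) :=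
  measurable_pi_lambda _ h.marks.measurable

theorem measurable_conditional [IsProbabilityMeasure P] (h : IsMarkedPoisson x Phi lam P)
    {E : Set ((ℕ → Plane) × (ℕ → ℝ))} (hE : MeasurableSet E) :
    Measurable fun w => P {w' | (fun i => x i w, fun i => Phi i w') ∈ E} := by
  have h2 : MeasurableSet {q : Ω × Ω | (fun i => x i q.1, fun i => Phi i q.2) ∈ E} :=
    ((h.measurable_points.comp measurable_fst).prodMk (h.measurable_marks.comp measurable_snd)) hE
  exact measurable_measure_prodMk_left h2

/-- Positions and marks are independent, so the marks may be resampled on a second copy of `Ω`. The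
inner probability then plays the role of the conditional probability given the positions. -/
theorem measure_eq_lintegral [IsProbabilityMeasure P] (h : IsMarkedPoisson x Phi lam P)
    {E : Set ((ℕ → Plane) × (ℕ → ℝ))} (hE : MeasurableSet E) :
    P {w | (fun i => x i w, fun i => Phi i w) ∈ E} =
      ∫⁻ w, P {w' | (fun i => x i w, fun i => Phi i w') ∈ E} ∂P := by
  have hx := h.measurable_points
  have hp := h.measurable_marks
  have h1 := (indepFun_iff_map_prod_eq_prod_map_map hx.aemeasurable hp.aemeasurable).1 h.indep
  have h2 := Measure.map_apply (μ := P) (hx.prodMk hp) hE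
  have := Measure.isProbabilityMeasure_map (μ := P) hp.aemeasurable
  rw [h1, Measure.prod_apply hE, lintegral_map (measurable_measure_prodMk_left hE) hx] at h2
  change P (_ ⁻¹' E) = _
  rw [← h2]
  refine lintegral_congr fun w => ?_
  rw [Measure.map_apply hp (measurable_prodMk_left hE)]
  rfl

theorem measurableSet_dominates {B : Set Plane} (hB : MeasurableSet B) (i : ℕ) :
    MeasurableSet {q : (ℕ → Plane) × (ℕ → ℝ) | ∀ j, j ≠ i → q.1 j ∈ B → q.2 j < q.2 i} := by
  rw [Set.ofPred_forall]
  refine MeasurableSet.iInter fun j => ?_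
  by_cases hj : j = i
  · simp [hj]
  · simp only [ne_eq, hj, not_false_eq_true, true_imp_iff]
    have h1 : MeasurableSet {q : (ℕ → Plane) × (ℕ → ℝ) | q.1 j ∈ B} :=
      ((measurable_pi_apply j).comp measurable_fst) hB
    have h2 : MeasurableSet {q : (ℕ → Plane) × (ℕ → ℝ) | q.2 j < q.2 i} :=
      measurableSet_lt (by fun_prop) (by fun_prop)
    simp_rw [imp_iff_not_or]
    exact h1.compl.union h2

theorem pow_pointNum_measurable (h : IsMarkedPoisson x Phi lam P) {B : Set Plane}
    (hB : MeasurableSet B) (g : ℕ → ℕ) {β : Type*} [MeasurableSpace β] {f : β → ℝ≥0∞} (hf : Measurable f) :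
    Measurable fun q : Ω × β => f q.2 ^ g (pointNum x B q.1) :=
  (hf.comp measurable_snd).pow ((Measurable.of_discrete (f := g)).comp
    ((h.poisson.measurable_pointNum hB).comp measurable_fst))

/-- First moment measure of the points of `A` whose mark exceeds all other marks in `B`. -/
theorem tsum_measure_dominates [IsProbabilityMeasure P] (h : IsMarkedPoisson x Phi lam P) (hl : 0 ≤ lam)
    {A B : Set Plane} (hA : MeasurableSet A) (hB : MeasurableSet B) (hAB : A ⊆ B) (hv : volume B ≠ ∞) :
    ∑' i, P {w | x i w ∈ A ∧ ∀ j, j ≠ i → x j w ∈ B → Phi j w < Phi i w} =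
      ENNReal.ofReal (lam * volume.real A) *
        ∫⁻ s in Icc (0 : ℝ) 1, ENNReal.ofReal (Real.exp (-(lam * volume.real B * (1 - s)))) := by
  classical
  have hvA : volume A ≠ ∞ := measure_ne_top_of_subset hAB hv
  have hvD : volume (B \ A) ≠ ∞ := measure_ne_top_of_subset sdiff_subset hv
  let E (i : ℕ) : Set ((ℕ → Plane) × (ℕ → ℝ)) :=
    {q | q.1 i ∈ A} ∩ {q | ∀ j, j ≠ i → q.1 j ∈ B → q.2 j < q.2 i}
  have hE (i : ℕ) : MeasurableSet (E i) :=
    (((measurable_pi_apply i).comp measurable_fst) hA).inter (measurableSet_dominates hB i)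
  have h1 (i : ℕ) : P {w | x i w ∈ A ∧ ∀ j, j ≠ i → x j w ∈ B → Phi j w < Phi i w} =
      ∫⁻ w, P {w' | (fun i => x i w, fun i => Phi i w') ∈ E i} ∂P := by
    rw [← h.measure_eq_lintegral (hE i)]; rfl
  simp_rw [h1]
  rw [← lintegral_tsum fun i => (h.measurable_conditional (hE i)).aemeasurable]
  -- Given the positions, every point of `A` contributes the same integral, its competitors being
  -- the other `pointNum x A w - 1` points of `A` and all points of `B \ A`. Splitting `B` in this
  -- way produces counts that are independent.
  have h2 : ∀ᵐ w ∂P, ∑' i, P {w' | (fun i => x i w, fun i => Phi i w') ∈ E i} =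
      ∫⁻ s in Icc (0 : ℝ) 1, (pointNum x A w * ENNReal.ofReal s ^ (pointNum x A w - 1)) *
        ENNReal.ofReal s ^ pointNum x (B \ A) w := by
    filter_upwards [h.poisson.ae_finite hl hB hv] with w hw
    have hfA : {i | x i w ∈ A}.Finite := hw.subset fun i hi => hAB hi
    have hfD : {i | x i w ∈ B \ A}.Finite := hw.subset fun i hi => hi.1
    have e (i : ℕ) : P {w' | (fun i => x i w, fun i => Phi i w') ∈ E i} =
        if x i w ∈ A then ∫⁻ s in Icc (0 : ℝ) 1, ENNReal.ofReal s ^ (pointNum x A w - 1) *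
          ENNReal.ofReal s ^ pointNum x (B \ A) w else 0 := by
      split_ifs with hi
      · have := h.marks.measure_maximum (hw.toFinset.erase i) (Finset.notMem_erase i _)
        have e2 : {w' | (fun i => x i w, fun i => Phi i w') ∈ E i} =
            {w' | ∀ j ∈ hw.toFinset.erase i, Phi j w' < Phi i w'} := by
          ext w'
          simp [E, hi]
        rw [e2, this]
        refine lintegral_congr fun s => ?_
        rw [← pow_add]
        congr 1
        rw [pointNum_eq_card (J := hfA.toFinset) (by simp), pointNum_eq_card (J := hfD.toFinset) (by simp),
          Finset.card_erase_of_mem (by simpa using hAB hi)]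
        have hpos : 0 < hfA.toFinset.card := Finset.card_pos.2 ⟨i, by simpa using hi⟩
        have hun : hw.toFinset = hfA.toFinset ∪ hfD.toFinset := by
          ext j; simp only [Finite.mem_toFinset, mem_ofPred_eq, Finset.mem_union, mem_sdiff]
          constructor
          · intro hj; by_cases hjA : x j w ∈ A <;> simp [hj, hjA]
          · rintro (hj | hj); exacts [hAB hj, hj.1]
        rw [hun, Finset.card_union_of_disjoint]
        · omega
        · rw [Finset.disjoint_left]; intro j; simp; tauto
      · simp [E, hi]
    simp_rw [e]
    rw [tsum_ite_mem_eq_pointNum hfA, ← lintegral_const_mul' _ _ (by simp)]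
    simp_rw [mul_assoc]
  rw [lintegral_congr_ae h2, lintegral_lintegral_swap]
  · rw [← lintegral_const_mul' _ _ ENNReal.ofReal_ne_top]
    refine setLIntegral_congr_fun measurableSet_Icc fun s hs => ?_
    -- At a fixed mark `s` the selected point uses the differentiated generating function on `A` and
    -- the remaining region the plain one; the exponents add up to the volume of `B`.
    have h3 := h.poisson.lintegral_prod_pointNum ![A, B \ A]
      (by intro j; fin_cases j; exacts [hA, hB.diff hA])
      (by intro j; fin_cases j; exacts [hvA, hvD])
      (by
        intro j l hjl
        fin_cases j <;> fin_cases l <;> simp_all [disjoint_sdiff_right, disjoint_sdiff_left])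
      ![fun n => n * ENNReal.ofReal s ^ (n - 1), fun n => ENNReal.ofReal s ^ n]
    simp only [Fin.prod_univ_two, Matrix.cons_val_zero, Matrix.cons_val_one] at h3
    beta_reduce
    rw [h3, h.poisson.lintegral_mul_pow_pointNum hl hA hvA hs.1,
      h.poisson.lintegral_pow_pointNum hl (hB.diff hA) hvD hs.1, mul_assoc,
      ← ENNReal.ofReal_mul (Real.exp_nonneg _), ← Real.exp_add, measureReal_sdiff hAB hA hv]
    congr 3
    ring
  · refine Measurable.aemeasurable ?_
    have m := h.pow_pointNum_measurable hA (fun n => n - 1) ENNReal.measurable_ofReal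
    have m' := h.pow_pointNum_measurable (hB.diff hA) id ENNReal.measurable_ofReal
    have m0 : Measurable fun q : Ω × ℝ => (pointNum x A q.1 : ℝ≥0∞) :=
      (Measurable.of_discrete (f := fun n : ℕ => (n : ℝ≥0∞))).comp
        ((h.poisson.measurable_pointNum hA).comp measurable_fst)
    exact (m0.mul m).mul m'

end IsMarkedPoisson

end

/-! ### Second moments for competition in two fixed regions. -/

section

variable {Ω : Type*} [MeasurableSpace Ω]

namespace IsMarkedPoisson

variable {x : ℕ → Ω → Plane} {Phi : ℕ → Ω → ℝ} {lam : ℝ} {P : Measure Ω}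

theorem pointNum_nat_measurable (h : IsMarkedPoisson x Phi lam P) {A : Set Plane}
    (hA : MeasurableSet A) {β : Type*} [MeasurableSpace β] :
    Measurable fun q : Ω × β => (pointNum x A q.1 : ℝ≥0∞) :=
  (Measurable.of_discrete (f := fun n : ℕ => (n : ℝ≥0∞))).comp
    ((h.poisson.measurable_pointNum hA).comp measurable_fst)

/-- The two inclusions make `i` and `u` no competitors of each other. The remaining points split
into those competing with `i` only, with `u` only, and with both (the points of `B ∩ B'`); each `-
1` removes the selected point itself. -/
theorem measure_two_dominate [IsProbabilityMeasure P] (h : IsMarkedPoisson x Phi lam P)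
    {A A' B B' : Set Plane} (hAB : A ⊆ B \ B') (hAB' : A' ⊆ B' \ B) {w : Ω}
    (hw : {i | x i w ∈ B}.Finite) (hw' : {i | x i w ∈ B'}.Finite) {i u : ℕ}
    (hi : x i w ∈ A) (hu : x u w ∈ A') :
    P {w' | (∀ j, j ≠ i → x j w ∈ B → Phi j w' < Phi i w') ∧
        ∀ j, j ≠ u → x j w ∈ B' → Phi j w' < Phi u w'} =
      ∫⁻ s in Icc (0 : ℝ) 1, ∫⁻ t in Icc (0 : ℝ) 1,
        (ENNReal.ofReal s ^ (pointNum x A w - 1) * ENNReal.ofReal s ^ pointNum x ((B \ B') \ A) w) *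
        (ENNReal.ofReal t ^ (pointNum x A' w - 1) * ENNReal.ofReal t ^ pointNum x ((B' \ B) \ A') w) *
          ENNReal.ofReal (min s t) ^ pointNum x (B ∩ B') w := by
  have hfin {C : Set Plane} (hC : C ⊆ B ∪ B') : {j | x j w ∈ C}.Finite :=
    (hw.union hw').subset fun j hj => hC hj
  have hiu : i ≠ u := by
    rintro rfl
    exact (hAB hi).2 (hAB' hu).1
  have c1 {C D : Set Plane} (hCD : C ⊆ D) (hD : D ⊆ B ∪ B') {i : ℕ} (hi : x i w ∈ C) (J : Finset ℕ)
      (hJ : ∀ j, j ∈ J ↔ j ≠ i ∧ x j w ∈ D) :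
      J.card = (pointNum x C w - 1) + pointNum x (D \ C) w := by
    have hfC := hfin (hCD.trans hD)
    have hfD := hfin ((sdiff_subset (s := D) (t := C)).trans hD)
    rw [pointNum_eq_card (J := hfC.toFinset) (by simp), pointNum_eq_card (J := hfD.toFinset) (by simp)]
    have hJe : J = (hfC.toFinset.erase i) ∪ hfD.toFinset := by
      ext j
      simp only [hJ, Finset.mem_union, Finset.mem_erase, Finite.mem_toFinset, mem_ofPred_eq, mem_sdiff]
      constructor
      · rintro ⟨h1, h2⟩; by_cases hC : x j w ∈ C <;> simp [h1, h2, hC]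
      · rintro (⟨h1, h2⟩ | ⟨h1, h2⟩)
        · exact ⟨h1, hCD h2⟩
        · exact ⟨by rintro rfl; exact h2 hi, h1⟩
    rw [hJe, Finset.card_union_of_disjoint, Finset.card_erase_of_mem (by simpa using hi)]
    rw [Finset.disjoint_left]; intro j; simp; tauto
  have key := h.marks.measure_two_maxima hiu (hw.toFinset.erase i) (hw'.toFinset.erase u)
    (by simp [(hAB hi).2]) (by simp [(hAB' hu).2])
  have e2 : {w' | (∀ j, j ≠ i → x j w ∈ B → Phi j w' < Phi i w') ∧
        ∀ j, j ≠ u → x j w ∈ B' → Phi j w' < Phi u w'} =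
      {w' | (∀ j ∈ hw.toFinset.erase i, Phi j w' < Phi i w') ∧
        ∀ j ∈ hw'.toFinset.erase u, Phi j w' < Phi u w'} := by
    ext w'
    simp
  rw [e2, key]
  refine lintegral_congr fun s => lintegral_congr fun t => ?_
  rw [← pow_add, ← pow_add]
  have hnu : ∀ j, x j w ∈ B → j ≠ u := by rintro j hj rfl; exact (hAB' hu).2 hj
  have hni : ∀ j, x j w ∈ B' → j ≠ i := by rintro j hj rfl; exact (hAB hi).2 hj
  congr 1
  · congr 1
    · congr 1
      refine c1 hAB (sdiff_subset.trans subset_union_left) hi _ fun j => ?_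
      simp only [Finset.mem_sdiff, Finset.mem_erase, Finite.mem_toFinset, mem_ofPred_eq, mem_sdiff]
      have := hnu j; tauto
    · congr 1
      refine c1 hAB' (sdiff_subset.trans subset_union_right) hu _ fun j => ?_
      simp only [Finset.mem_sdiff, Finset.mem_erase, Finite.mem_toFinset, mem_ofPred_eq, mem_sdiff]
      have := hni j; tauto
  · congr 1
    symm
    refine pointNum_eq_card fun j => ?_
    simp only [Finset.mem_inter, Finset.mem_erase, Finite.mem_toFinset, mem_ofPred_eq, mem_inter_iff]
    have := hnu j; have := hni j; tauto

/-- The five regions `A`, `(B \ B') \ A`, `A'`, `(B' \ B) \ A'`, `B ∩ B'` are pairwise disjoint, so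
their counts are independent. `A` and `A'` carry the selected points and give differentiated
generating functions. -/
theorem lintegral_two_point_kernel [IsProbabilityMeasure P] (h : IsMarkedPoisson x Phi lam P) (hl : 0 ≤ lam)
    {A A' B B' : Set Plane} (hA : MeasurableSet A) (hA' : MeasurableSet A') (hB : MeasurableSet B)
    (hB' : MeasurableSet B') (hAB : A ⊆ B \ B') (hAB' : A' ⊆ B' \ B) (hv : volume B ≠ ∞)
    (hv' : volume B' ≠ ∞) {s t r : ℝ} (hs : 0 ≤ s) (ht : 0 ≤ t) (hr : 0 ≤ r) :
    ∫⁻ w, (pointNum x A w * ENNReal.ofReal s ^ (pointNum x A w - 1) *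
        ENNReal.ofReal s ^ pointNum x ((B \ B') \ A) w) *
        (pointNum x A' w * ENNReal.ofReal t ^ (pointNum x A' w - 1) *
        ENNReal.ofReal t ^ pointNum x ((B' \ B) \ A') w) *
          ENNReal.ofReal r ^ pointNum x (B ∩ B') w ∂P =
      ENNReal.ofReal (lam * volume.real A) * ENNReal.ofReal (lam * volume.real A') *
        ENNReal.ofReal (Real.exp (-(lam * (volume.real (B \ B') * (1 - s) +
          volume.real (B' \ B) * (1 - t) + volume.real (B ∩ B') * (1 - r))))) := by
  have hvD : volume (B \ B') ≠ ∞ := measure_ne_top_of_subset sdiff_subset hv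
  have hvD' : volume (B' \ B) ≠ ∞ := measure_ne_top_of_subset sdiff_subset hv'
  have hvA : volume A ≠ ∞ := measure_ne_top_of_subset hAB hvD
  have hvA' : volume A' ≠ ∞ := measure_ne_top_of_subset hAB' hvD'
  have hvI : volume (B ∩ B') ≠ ∞ := measure_ne_top_of_subset inter_subset_left hv
  have hm := (hB.diff hB').diff hA
  have hm' := (hB'.diff hB).diff hA'
  have hvC : volume ((B \ B') \ A) ≠ ∞ := measure_ne_top_of_subset sdiff_subset hvD
  have hvC' : volume ((B' \ B) \ A') ≠ ∞ := measure_ne_top_of_subset sdiff_subset hvD'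
  have h3 := h.poisson.lintegral_prod_pointNum ![A, (B \ B') \ A, A', (B' \ B) \ A', B ∩ B']
    (by intro j; fin_cases j; exacts [hA, hm, hA', hm', hB.inter hB'])
    (by intro j; fin_cases j; exacts [hvA, hvC, hvA', hvC', hvI])
    (by
      have d {C D : Set Plane} (H : ∀ z, z ∈ C → z ∈ D → False) : Disjoint C D ∧ Disjoint D C :=
        ⟨Set.disjoint_left.2 H, Set.disjoint_right.2 H⟩
      have a1 := d (C := A) (D := (B \ B') \ A) fun z h1 h2 => h2.2 h1
      have a2 := d (C := A) (D := A') fun z h1 h2 => (hAB h1).2 (hAB' h2).1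
      have a3 := d (C := A) (D := (B' \ B) \ A') fun z h1 h2 => (hAB h1).2 h2.1.1
      have a4 := d (C := A) (D := B ∩ B') fun z h1 h2 => (hAB h1).2 h2.2
      have a5 := d (C := (B \ B') \ A) (D := A') fun z h1 h2 => h1.1.2 (hAB' h2).1
      have a6 := d (C := (B \ B') \ A) (D := (B' \ B) \ A') fun z h1 h2 => h1.1.2 h2.1.1
      have a7 := d (C := (B \ B') \ A) (D := B ∩ B') fun z h1 h2 => h1.1.2 h2.2
      have a8 := d (C := A') (D := (B' \ B) \ A') fun z h1 h2 => h2.2 h1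
      have a9 := d (C := A') (D := B ∩ B') fun z h1 h2 => (hAB' h1).2 h2.1
      have a10 := d (C := (B' \ B) \ A') (D := B ∩ B') fun z h1 h2 => h1.1.2 h2.1
      intro j l hjl
      fin_cases j <;> fin_cases l <;> first | exact absurd rfl hjl | skip
      exacts [a1.1, a2.1, a3.1, a4.1, a1.2, a5.1, a6.1, a7.1, a2.2, a5.2, a8.1, a9.1,
        a3.2, a6.2, a8.2, a10.1, a4.2, a7.2, a9.2, a10.2])
    ![fun n => n * ENNReal.ofReal s ^ (n - 1), fun n => ENNReal.ofReal s ^ n,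
      fun n => n * ENNReal.ofReal t ^ (n - 1), fun n => ENNReal.ofReal t ^ n,
      fun n => ENNReal.ofReal r ^ n]
  simp only [Fin.prod_univ_five, Matrix.cons_val] at h3
  simp_rw [← mul_assoc] at h3 ⊢
  rw [h3, h.poisson.lintegral_mul_pow_pointNum hl hA hvA hs,
    h.poisson.lintegral_pow_pointNum hl hm hvC hs,
    h.poisson.lintegral_mul_pow_pointNum hl hA' hvA' ht,
    h.poisson.lintegral_pow_pointNum hl hm' hvC' ht,
    h.poisson.lintegral_pow_pointNum hl (hB.inter hB') hvI hr,
    measureReal_sdiff hAB hA hvD, measureReal_sdiff hAB' hA' hvD']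
  set a := volume.real A
  set a' := volume.real A'
  have : Real.exp (-(lam * (volume.real (B \ B') * (1 - s) +
          volume.real (B' \ B) * (1 - t) + volume.real (B ∩ B') * (1 - r)))) =
      Real.exp (-(lam * a * (1 - s))) * Real.exp (-(lam * (volume.real (B \ B') - a) * (1 - s))) *
      (Real.exp (-(lam * a' * (1 - t))) * Real.exp (-(lam * (volume.real (B' \ B) - a') * (1 - t)))) *
      Real.exp (-(lam * volume.real (B ∩ B') * (1 - r))) := by
    simp only [← Real.exp_add]
    ring_nf
  have e0 (y : ℝ) : 0 ≤ Real.exp y := Real.exp_nonneg y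
  rw [this, ENNReal.ofReal_mul (mul_nonneg (mul_nonneg (e0 _) (e0 _)) (mul_nonneg (e0 _) (e0 _))),
    ENNReal.ofReal_mul (mul_nonneg (e0 _) (e0 _)), ENNReal.ofReal_mul (e0 _),
    ENNReal.ofReal_mul (e0 _)]
  ring

/-- Second moment measure of pairs of points of `A` and `A'` whose marks exceed all other marks
in `B` and `B'`, respectively. -/
theorem tsum_measure_two_dominate [IsProbabilityMeasure P] (h : IsMarkedPoisson x Phi lam P) (hl : 0 ≤ lam)
    {A A' B B' : Set Plane} (hA : MeasurableSet A) (hA' : MeasurableSet A') (hB : MeasurableSet B)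
    (hB' : MeasurableSet B') (hAB : A ⊆ B \ B') (hAB' : A' ⊆ B' \ B) (hv : volume B ≠ ∞)
    (hv' : volume B' ≠ ∞) :
    ∑' i, ∑' u, P {w | (x i w ∈ A ∧ x u w ∈ A') ∧
        (∀ j, j ≠ i → x j w ∈ B → Phi j w < Phi i w) ∧
        ∀ j, j ≠ u → x j w ∈ B' → Phi j w < Phi u w} =
      ENNReal.ofReal (lam * volume.real A) * ENNReal.ofReal (lam * volume.real A') *
        ∫⁻ s in Icc (0 : ℝ) 1, ∫⁻ t in Icc (0 : ℝ) 1,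
          ENNReal.ofReal (Real.exp (-(lam * (volume.real (B \ B') * (1 - s) +
            volume.real (B' \ B) * (1 - t) + volume.real (B ∩ B') * (1 - min s t))))) := by
  classical
  set U : Measure ℝ := volume.restrict (Icc (0 : ℝ) 1) with hU
  let E (i u : ℕ) : Set ((ℕ → Plane) × (ℕ → ℝ)) :=
    ({q | q.1 i ∈ A} ∩ {q | q.1 u ∈ A'}) ∩ ({q | ∀ j, j ≠ i → q.1 j ∈ B → q.2 j < q.2 i} ∩
      {q | ∀ j, j ≠ u → q.1 j ∈ B' → q.2 j < q.2 u})
  have hE (i u : ℕ) : MeasurableSet (E i u) :=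
    ((((measurable_pi_apply i).comp measurable_fst) hA).inter
      (((measurable_pi_apply u).comp measurable_fst) hA')).inter
      ((measurableSet_dominates hB i).inter (measurableSet_dominates hB' u))
  have h1 (i u : ℕ) : P {w | (x i w ∈ A ∧ x u w ∈ A') ∧
        (∀ j, j ≠ i → x j w ∈ B → Phi j w < Phi i w) ∧
        ∀ j, j ≠ u → x j w ∈ B' → Phi j w < Phi u w} =
      ∫⁻ w, P {w' | (fun i => x i w, fun i => Phi i w') ∈ E i u} ∂P := by
    rw [← h.measure_eq_lintegral (hE i u)]; rfl
  simp_rw [h1]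
  simp_rw [← lintegral_tsum fun u => (h.measurable_conditional (hE _ u)).aemeasurable]
  rw [← lintegral_tsum fun i => (Measurable.tsum fun u =>
    (h.measurable_conditional (hE i u))).aemeasurable]
  let G (q : Ω × (ℝ × ℝ)) : ℝ≥0∞ :=
    (pointNum x A q.1 * ENNReal.ofReal q.2.1 ^ (pointNum x A q.1 - 1) *
        ENNReal.ofReal q.2.1 ^ pointNum x ((B \ B') \ A) q.1) *
        (pointNum x A' q.1 * ENNReal.ofReal q.2.2 ^ (pointNum x A' q.1 - 1) *
        ENNReal.ofReal q.2.2 ^ pointNum x ((B' \ B) \ A') q.1) *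
          ENNReal.ofReal (min q.2.1 q.2.2) ^ pointNum x (B ∩ B') q.1
  have hm := (hB.diff hB').diff hA
  have hm' := (hB'.diff hB).diff hA'
  have hG : Measurable G := by
    have f1 : Measurable fun q : ℝ × ℝ => ENNReal.ofReal q.1 := by fun_prop
    have f2 : Measurable fun q : ℝ × ℝ => ENNReal.ofReal q.2 := by fun_prop
    have f3 : Measurable fun q : ℝ × ℝ => ENNReal.ofReal (min q.1 q.2) := by fun_prop
    exact ((((h.pointNum_nat_measurable hA).mul
        (h.pow_pointNum_measurable hA (fun n => n - 1) f1)).mul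
      (h.pow_pointNum_measurable hm id f1)).mul
      (((h.pointNum_nat_measurable hA').mul
        (h.pow_pointNum_measurable hA' (fun n => n - 1) f2)).mul
      (h.pow_pointNum_measurable hm' id f2))).mul
      (h.pow_pointNum_measurable (hB.inter hB') id f3)
  -- For fixed positions all pairs in `A × A'` have the same conditional probability, so the double
  -- sum is a product of two counts and one integral over the two marks.
  have h2 : ∀ᵐ w ∂P, ∑' i, ∑' u, P {w' | (fun i => x i w, fun i => Phi i w') ∈ E i u} =
      ∫⁻ q, G (w, q) ∂(U.prod U) := by
    filter_upwards [h.poisson.ae_finite hl hB hv, h.poisson.ae_finite hl hB' hv'] with w hw hw'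
    have hfA : {i | x i w ∈ A}.Finite := hw.subset fun i hi => (hAB hi).1
    have hfA' : {i | x i w ∈ A'}.Finite := hw'.subset fun i hi => (hAB' hi).1
    set I := ∫⁻ s, ∫⁻ t,
        (ENNReal.ofReal s ^ (pointNum x A w - 1) * ENNReal.ofReal s ^ pointNum x ((B \ B') \ A) w) *
        (ENNReal.ofReal t ^ (pointNum x A' w - 1) * ENNReal.ofReal t ^ pointNum x ((B' \ B) \ A') w) *
          ENNReal.ofReal (min s t) ^ pointNum x (B ∩ B') w ∂U ∂U with hI
    have e (i u : ℕ) : P {w' | (fun i => x i w, fun i => Phi i w') ∈ E i u} =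
        if x i w ∈ A then (if x u w ∈ A' then I else 0) else 0 := by
      split_ifs with hi hu
      · rw [hI, ← h.measure_two_dominate hAB hAB' hw hw' hi hu]
        congr 1
        ext w'
        simp [E, hi, hu]
      · simp [E, hi, hu]
      · simp [E, hi]
    have e' (i : ℕ) : ∑' u, P {w' | (fun i => x i w, fun i => Phi i w') ∈ E i u} =
        if x i w ∈ A then pointNum x A' w * I else 0 := by
      simp_rw [e]
      split_ifs with hi
      · exact tsum_ite_mem_eq_pointNum hfA' I
      · simp
    simp_rw [e']
    rw [tsum_ite_mem_eq_pointNum hfA, ← mul_assoc, hI, lintegral_prod (fun q => G (w, q)) (hG.comp measurable_prodMk_left).aemeasurable,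
      ← lintegral_const_mul' _ _ (ENNReal.mul_ne_top (by simp) (by simp))]
    refine lintegral_congr fun s => ?_
    rw [← lintegral_const_mul' _ _ (ENNReal.mul_ne_top (by simp) (by simp))]
    refine lintegral_congr fun t => ?_
    simp only [G]
    ring
  rw [lintegral_congr_ae h2, lintegral_lintegral_swap (f := fun w q => G (w, q)) hG.aemeasurable,
    lintegral_prod _ (Measurable.lintegral_prod_left' (f := G) hG).aemeasurable,
    ← lintegral_const_mul' _ _ (ENNReal.mul_ne_top ENNReal.ofReal_ne_top ENNReal.ofReal_ne_top)]
  refine setLIntegral_congr_fun measurableSet_Icc fun s hs => ?_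
  beta_reduce
  rw [← lintegral_const_mul' _ _ (ENNReal.mul_ne_top ENNReal.ofReal_ne_top ENNReal.ofReal_ne_top)]
  refine setLIntegral_congr_fun measurableSet_Icc fun t ht => ?_
  exact h.lintegral_two_point_kernel hl hA hA' hB hB' hAB hAB' hv hv' hs.1 ht.1 (le_min hs.1 ht.1)

end IsMarkedPoisson

end

/-! ### The pair kernel and its closed form. -/

section

theorem lintegral_Icc_ofReal {f : ℝ → ℝ} (hf : Continuous f) (h0 : ∀ s, 0 ≤ f s) :
    ∫⁻ s in Icc (0 : ℝ) 1, ENNReal.ofReal (f s) = ENNReal.ofReal (∫ s in (0 : ℝ)..1, f s) := by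
  rw [intervalIntegral.integral_of_le zero_le_one, ← integral_Icc_eq_integral_Ioc,
    ofReal_integral_eq_lintegral_ofReal (hf.integrableOn_Icc) (.of_forall h0)]

theorem intervalIntegral_exp_affine {c : ℝ} (hc : c ≠ 0) (d a b : ℝ) :
    ∫ t in a..b, Real.exp (c * t + d) = (Real.exp (c * b + d) - Real.exp (c * a + d)) / c := by
  rw [intervalIntegral.integral_comp_mul_add (fun y => Real.exp y) hc, integral_exp, smul_eq_mul]
  field_simp

theorem lintegral_exp_neg_mul_one_sub {c : ℝ} (hc : c ≠ 0) :
    ∫⁻ s in Icc (0 : ℝ) 1, ENNReal.ofReal (Real.exp (-(c * (1 - s)))) =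
      ENNReal.ofReal ((1 - Real.exp (-c)) / c) := by
  rw [lintegral_Icc_ofReal (by fun_prop) fun s => (Real.exp_pos _).le]
  congr 1
  rw [intervalIntegral.integral_congr (g := fun s => Real.exp (c * s + -c)) fun s _ => by ring_nf,
    intervalIntegral_exp_affine hc]
  simp

/-- For marked points in Poisson clusters of area `D` with union of area `V`, the probability that
two given points both have the largest mark in their clusters. -/
noncomputable def pairKernel (lam D V : ℝ) : ℝ≥0∞ :=
  ∫⁻ s in Icc (0 : ℝ) 1, ∫⁻ t in Icc (0 : ℝ) 1,
    ENNReal.ofReal (Real.exp (-(lam * (|t - s| * D + (1 - max s t) * V))))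

/-- The inner integral is split at `t = s`, where `|t - s|` and `max s t` change form; both pieces
are exponentials of affine functions. `D < V` keeps the exponent `lam * (V - D)` nonzero. -/
theorem pairKernel_eq {lam D V : ℝ} (hl : 0 < lam) (hD : 0 < D) (hV : D < V) :
    pairKernel lam D V = ENNReal.ofReal ((2 * V * (1 - Real.exp (-(lam * D))) -
      2 * D * (1 - Real.exp (-(lam * V)))) / (lam ^ 2 * D * V * (V - D))) := by
  have hV0 : 0 < V := hD.trans hV
  have hVD : 0 < V - D := sub_pos.2 hV
  have inner : ∀ s ∈ Icc (0 : ℝ) 1,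
      ∫ t in (0 : ℝ)..1, Real.exp (-(lam * (|t - s| * D + (1 - max s t) * V))) =
        (Real.exp (lam * V * s + -(lam * V)) - Real.exp (lam * (V - D) * s + -(lam * V))) / (lam * D) +
        (Real.exp (lam * D * s + -(lam * D)) - Real.exp (lam * V * s + -(lam * V))) / (lam * (V - D)) := by
    intro s hs
    have hc : Continuous fun t : ℝ => Real.exp (-(lam * (|t - s| * D + (1 - max s t) * V))) := by
      fun_prop
    rw [← intervalIntegral.integral_add_adjacent_intervals (b := s) (hc.intervalIntegrable _ _)
      (hc.intervalIntegrable _ _)]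
    congr 1
    · rw [intervalIntegral.integral_congr
        (g := fun t => Real.exp (lam * D * t + (-(lam * (s * D + (1 - s) * V))))),
        intervalIntegral_exp_affine (by positivity)]
      · congr 2 <;> ring_nf
      · intro t ht
        rw [uIcc_of_le hs.1] at ht
        simp only [abs_of_nonpos (sub_nonpos.2 ht.2), max_eq_left ht.2]
        ring_nf
    · rw [intervalIntegral.integral_congr
        (g := fun t => Real.exp (lam * (V - D) * t + (-(lam * (V - s * D))))),
        intervalIntegral_exp_affine (by positivity)]
      · congr 2 <;> ring_nf
      · intro t ht
        rw [uIcc_of_le hs.2] at ht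
        simp only [abs_of_nonneg (sub_nonneg.2 ht.1), max_eq_right ht.1]
        ring_nf
  rw [pairKernel]
  rw [setLIntegral_congr_fun measurableSet_Icc fun s hs => by
    rw [lintegral_Icc_ofReal (by fun_prop) fun t => (Real.exp_pos _).le]]
  have h0 : ∀ s : ℝ, 0 ≤ ∫ t in (0 : ℝ)..1, Real.exp (-(lam * (|t - s| * D + (1 - max s t) * V))) :=
    fun s => intervalIntegral.integral_nonneg zero_le_one fun t _ => (Real.exp_pos _).le
  rw [lintegral_Icc_ofReal ?_ h0]
  · congr 1
    rw [intervalIntegral.integral_congr (fun s hs => inner s (by rwa [uIcc_of_le zero_le_one] at hs))]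
    have ii (c d : ℝ) : IntervalIntegrable (fun s => Real.exp (c * s + d)) volume 0 1 :=
      Continuous.intervalIntegrable (by fun_prop) _ _
    rw [intervalIntegral.integral_add (((ii _ _).sub (ii _ _)).div_const _)
      (((ii _ _).sub (ii _ _)).div_const _), intervalIntegral.integral_div, intervalIntegral.integral_div,
      intervalIntegral.integral_sub (ii _ _) (ii _ _), intervalIntegral.integral_sub (ii _ _) (ii _ _),
      intervalIntegral_exp_affine (by positivity), intervalIntegral_exp_affine (by positivity),
      intervalIntegral_exp_affine (by positivity)]
    have e1 : lam * V * 1 + -(lam * V) = 0 := by ring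
    have e2 : lam * (V - D) * 1 + -(lam * V) = -(lam * D) := by ring
    have e3 : lam * D * 1 + -(lam * D) = 0 := by ring
    rw [e1, e2, e3]
    simp only [mul_zero, zero_add, Real.exp_zero]
    have hVD' : V - D ≠ 0 := hVD.ne'
    field_simp
    ring
  · exact intervalIntegral.continuous_parametric_intervalIntegral_of_continuous'
      (f := fun s t => Real.exp (-(lam * (|t - s| * D + (1 - max s t) * V)))) (by fun_prop) _ _

/-- On the unit square `|t - s| + 2 * (1 - max s t) ≤ 2`, so area errors `k` and `2 * k` change the
exponent by at most `2 * lam * k`. The error is multiplicative and tends to 1 with `k → 0`. -/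
theorem pairKernel_le {lam D V D' V' k : ℝ} (hl : 0 ≤ lam) (hk : 0 ≤ k) (hD : D ≤ D' + k)
    (hV : V ≤ V' + 2 * k) :
    pairKernel lam D' V' ≤ ENNReal.ofReal (Real.exp (2 * lam * k)) * pairKernel lam D V := by
  rw [pairKernel, pairKernel, ← lintegral_const_mul' _ _ ENNReal.ofReal_ne_top]
  refine setLIntegral_mono' measurableSet_Icc fun s hs => ?_
  rw [← lintegral_const_mul' _ _ ENNReal.ofReal_ne_top]
  refine setLIntegral_mono' measurableSet_Icc fun t ht => ?_
  rw [← ENNReal.ofReal_mul (Real.exp_nonneg _), ← Real.exp_add]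
  refine ENNReal.ofReal_le_ofReal (Real.exp_le_exp.2 ?_)
  have h1 : 0 ≤ 1 - max s t := sub_nonneg.2 (max_le hs.2 ht.2)
  have h2 : |t - s| + 2 * (1 - max s t) ≤ 2 := by
    rcases le_total s t with h | h
    · rw [max_eq_right h, abs_of_nonneg (sub_nonneg.2 h)]; linarith [hs.1, ht.1]
    · rw [max_eq_left h, abs_of_nonpos (sub_nonpos.2 h)]; linarith [hs.1, ht.1]
  have h3 : |t - s| * D + (1 - max s t) * V ≤ |t - s| * D' + (1 - max s t) * V' + 2 * k := by
    have a1 := mul_le_mul_of_nonneg_left hD (abs_nonneg (t - s))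
    have a2 := mul_le_mul_of_nonneg_left hV h1
    have a3 := mul_le_mul_of_nonneg_right h2 hk
    nlinarith
  have := mul_le_mul_of_nonneg_left h3 hl
  linarith

end

/-! ### Area of the union of two disks. -/

section

/-- The antiderivative is `t √(δ² - t²) + δ² arcsin (t / δ)`. It need not be differentiable at `t =
δ`, hence the version of the fundamental theorem that asks for derivatives only in the open
interval. -/
theorem integral_sqrt_sq_sub_sq {d δ : ℝ} (hd : 0 ≤ d) (hdδ : d ≤ δ) (hδ : 0 < δ) :
    ∫ t in d..δ, 2 * Real.sqrt (δ ^ 2 - t ^ 2) =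
      δ ^ 2 * Real.arccos (d / δ) - d * Real.sqrt (δ ^ 2 - d ^ 2) := by
  have key := intervalIntegral.integral_eq_sub_of_hasDerivAt_of_le (a := d) (b := δ)
    (f := fun t => t * Real.sqrt (δ ^ 2 - t ^ 2) + δ ^ 2 * Real.arcsin (δ⁻¹ * t))
    (f' := fun t => 2 * Real.sqrt (δ ^ 2 - t ^ 2)) hdδ
    (Continuous.continuousOn (by
      have := Real.continuous_arcsin
      fun_prop)) ?_ (Continuous.intervalIntegrable (by fun_prop) _ _)
  · rw [key, Real.arccos, inv_mul_cancel₀ hδ.ne', Real.arcsin_one, sub_self, Real.sqrt_zero]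
    rw [show δ⁻¹ * d = d / δ by field_simp]
    ring
  · intro t ht
    have h1 : 0 < δ ^ 2 - t ^ 2 := by nlinarith [ht.1, ht.2]
    have h2 : δ⁻¹ * t < 1 := by rw [inv_mul_lt_iff₀ hδ]; linarith [ht.2]
    have h3 : -1 < δ⁻¹ * t := by
      have : 0 ≤ δ⁻¹ * t := mul_nonneg (inv_nonneg.2 hδ.le) (hd.trans ht.1.le)
      linarith
    have e : Real.sqrt (1 - (δ⁻¹ * t) ^ 2) = Real.sqrt (δ ^ 2 - t ^ 2) / δ := by
      rw [show 1 - (δ⁻¹ * t) ^ 2 = (δ ^ 2 - t ^ 2) / δ ^ 2 by field_simp,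
        Real.sqrt_div' _ (by positivity), Real.sqrt_sq hδ.le]
    have hs : 0 < Real.sqrt (δ ^ 2 - t ^ 2) := Real.sqrt_pos.2 h1
    have hs2 := Real.sq_sqrt h1.le
    have a1 := (hasDerivAt_id' t).mul
      ((((hasDerivAt_id' t).pow 2).const_sub (δ ^ 2)).sqrt h1.ne')
    have a2 := ((Real.hasDerivAt_arcsin h3.ne' h2.ne).comp t
      ((hasDerivAt_id' t).const_mul δ⁻¹)).const_mul (δ ^ 2)
    refine (a1.add a2).congr_deriv ?_
    simp only [Pi.pow_apply]
    rw [e]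
    have hs' := hs.ne'
    generalize Real.sqrt (δ ^ 2 - t ^ 2) = R at *
    field_simp
    rw [hs2]
    norm_num
    ring

theorem volume_sq_le (c : ℝ) :
    volume {b : ℝ | b ^ 2 ≤ c} = ENNReal.ofReal (2 * Real.sqrt c) := by
  rcases le_or_gt 0 c with hc | hc
  · have : {b : ℝ | b ^ 2 ≤ c} = Icc (-Real.sqrt c) (Real.sqrt c) := by
      ext b
      rw [mem_ofPred_eq, mem_Icc, ← abs_le, ← Real.sqrt_sq_eq_abs, Real.sqrt_le_sqrt_iff hc]
    rw [this, Real.volume_Icc]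
    ring_nf
  · have : {b : ℝ | b ^ 2 ≤ c} = ∅ := by
      ext b
      simp only [mem_ofPred_eq, mem_empty_iff_false, iff_false, not_le]
      nlinarith [sq_nonneg b]
    rw [this, Real.sqrt_eq_zero_of_nonpos hc.le]
    simp

/-- Area of a symmetric lens bounded by two circular arcs of radius `δ`. -/
theorem volume_lens_prod {d δ : ℝ} (hd : 0 ≤ d) (hdδ : d ≤ δ) (hδ : 0 < δ) :
    volume {q : ℝ × ℝ | (|q.1| + d) ^ 2 + q.2 ^ 2 ≤ δ ^ 2} =
      ENNReal.ofReal (2 * δ ^ 2 * Real.arccos (d / δ) - 2 * d * Real.sqrt (δ ^ 2 - d ^ 2)) := by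
  have hm : MeasurableSet {q : ℝ × ℝ | (|q.1| + d) ^ 2 + q.2 ^ 2 ≤ δ ^ 2} :=
    (isClosed_le (by fun_prop) (by fun_prop)).measurableSet
  -- The slice of the lens at abscissa `a` has length `f |a|`. Since `Real.sqrt` vanishes on
  -- negative numbers, slices with `|a| ≥ δ - d` contribute zero.
  let f : ℝ → ℝ := fun a => 2 * Real.sqrt (δ ^ 2 - (a + d) ^ 2)
  have hzero : ∀ a, δ - d ≤ a → f a = 0 := by
    intro a ha
    simp only [f]
    rw [Real.sqrt_eq_zero_of_nonpos (by nlinarith), mul_zero]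
  have hfc : Continuous fun a => f |a| := by fun_prop
  have hcs : HasCompactSupport fun a => f |a| := by
    refine HasCompactSupport.intro (isCompact_Icc (a := -(δ - d)) (b := δ - d)) fun a ha => ?_
    refine hzero _ ?_
    by_contra! h
    exact ha (abs_le.1 h.le)
  have hint := hfc.integrable_of_hasCompactSupport hcs (μ := volume)
  rw [Measure.volume_eq_prod, Measure.prod_apply hm]
  have h1 (a : ℝ) : volume (Prod.mk a ⁻¹' {q : ℝ × ℝ | (|q.1| + d) ^ 2 + q.2 ^ 2 ≤ δ ^ 2}) =
      ENNReal.ofReal (f |a|) := by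
    rw [← volume_sq_le]
    congr 1
    ext b
    simp only [mem_preimage, mem_ofPred_eq]
    constructor <;> intro h <;> linarith
  simp_rw [h1]
  rw [← ofReal_integral_eq_lintegral_ofReal hint (.of_forall fun a => by positivity), integral_comp_abs,
    setIntegral_eq_of_subset_of_forall_sdiff_eq_zero (s := Ioc 0 (δ - d)) measurableSet_Ioi
      (fun a ha => ha.1) (fun a ha => hzero a ?_), ← intervalIntegral.integral_of_le (by linarith),
    intervalIntegral.integral_comp_add_right (fun t => 2 * Real.sqrt (δ ^ 2 - t ^ 2)), zero_add,
    sub_add_cancel, integral_sqrt_sq_sub_sq hd hdδ hδ]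
  · congr 1; ring
  · by_contra! h
    exact ha.2 ⟨ha.1, h.le⟩

theorem Plane.norm_sq (z : Plane) : ‖z‖ ^ 2 = z 0 ^ 2 + z 1 ^ 2 := by
  rw [EuclideanSpace.norm_sq_eq]; simp

/-- Coordinates of the plane. -/
theorem Plane.measurePreserving_coord :
    MeasurePreserving (fun z : Plane => (z 0, z 1)) volume volume :=
  (volume_preserving_finTwoArrow ℝ).comp
    (EuclideanSpace.volume_preserving_symm_measurableEquiv_toLp (Fin 2))

/-- A rigid motion moves the midpoint of the centres to the origin and the centres onto the first
axis, at `∓ r / 2`; there the intersection is the lens with `d = r / 2`. -/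
theorem Plane.volume_inter_closedBall {δ : ℝ} (hδ : 0 < δ) {x y : Plane} (h0 : 0 < dist x y)
    (h2 : dist x y < 2 * δ) :
    volume (Metric.closedBall x δ ∩ Metric.closedBall y δ) =
      ENNReal.ofReal (2 * δ ^ 2 * Real.arccos (dist x y / (2 * δ)) -
        dist x y * Real.sqrt (δ ^ 2 - dist x y ^ 2 / 4)) := by
  set r := dist x y with hr
  have hn : ‖y - x‖ = ‖(EuclideanSpace.single 0 r : Plane)‖ := by
    rw [PiLp.norm_single, Real.norm_of_nonneg h0.le, hr, dist_comm, dist_eq_norm]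
  -- The reflection in the perpendicular bisector of two vectors of equal length exchanges them.
  set φ : Plane ≃ₗᵢ[ℝ] Plane := (ℝ ∙ ((y - x) - EuclideanSpace.single 0 r))ᗮ.reflection
  have hφ : φ (y - x) = EuclideanSpace.single 0 r := Submodule.reflection_sub hn
  set m : Plane := (1 / 2 : ℝ) • (x + y)
  have hmp : MeasurePreserving (fun z : Plane => φ (z - m)) volume volume :=
    φ.measurePreserving.comp (measurePreserving_sub_right volume m)
  have hmp2 := Plane.measurePreserving_coord.comp hmp
  have hx (z : Plane) : dist z x = ‖φ (z - m) + EuclideanSpace.single 0 (r / 2)‖ := by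
    have : (EuclideanSpace.single 0 (r / 2) : Plane) = φ ((1 / 2 : ℝ) • (y - x)) := by
      rw [map_smul, hφ]; ext i; fin_cases i <;> (simp; try ring)
    rw [this, ← map_add, φ.norm_map, dist_eq_norm]
    congr 1
    simp only [m]
    module
  have hy (z : Plane) : dist z y = ‖φ (z - m) - EuclideanSpace.single 0 (r / 2)‖ := by
    have : (EuclideanSpace.single 0 (r / 2) : Plane) = φ ((1 / 2 : ℝ) • (y - x)) := by
      rw [map_smul, hφ]; ext i; fin_cases i <;> (simp; try ring)
    rw [this, ← map_sub, φ.norm_map, dist_eq_norm]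
    congr 1
    simp only [m]
    module
  -- The farther of the two centres decides membership in both disks; its horizontal distance is
  -- `|q.1| + r / 2`.
  have hset : Metric.closedBall x δ ∩ Metric.closedBall y δ =
      ((fun z : Plane => (z 0, z 1)) ∘ fun z : Plane => φ (z - m)) ⁻¹'
        {q : ℝ × ℝ | (|q.1| + r / 2) ^ 2 + q.2 ^ 2 ≤ δ ^ 2} := by
    ext z
    have e1 : dist z x ≤ δ ↔ (φ (z - m) 0 + r / 2) ^ 2 + φ (z - m) 1 ^ 2 ≤ δ ^ 2 := by
      rw [← sq_le_sq₀ dist_nonneg hδ.le, hx, Plane.norm_sq]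
      simp
    have e2 : dist z y ≤ δ ↔ (φ (z - m) 0 - r / 2) ^ 2 + φ (z - m) 1 ^ 2 ≤ δ ^ 2 := by
      rw [← sq_le_sq₀ dist_nonneg hδ.le, hy, Plane.norm_sq]
      simp
    simp only [mem_inter_iff, Metric.mem_closedBall, e1, e2, mem_preimage, Function.comp, mem_ofPred_eq]
    set a := φ (z - m) 0
    rcases le_total 0 a with h | h
    · rw [abs_of_nonneg h]
      exact ⟨fun h => h.1, fun h' => ⟨h', by nlinarith⟩⟩
    · rw [abs_of_nonpos h]
      exact ⟨fun h => by nlinarith [h.2], fun h' => ⟨by nlinarith, by nlinarith⟩⟩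
  rw [hset, hmp2.measure_preimage, volume_lens_prod (by linarith) (by linarith) hδ]
  · congr 1
    rw [show r / 2 / δ = r / (2 * δ) by field_simp, show (r / 2) ^ 2 = r ^ 2 / 4 by ring]
    ring
  · exact ((isClosed_le (by fun_prop) (by fun_prop)).measurableSet).nullMeasurableSet

theorem Plane.volumeReal_closedBall (x : Plane) {r : ℝ} (hr : 0 ≤ r) :
    volume.real (Metric.closedBall x r) = Real.pi * r ^ 2 := by
  rw [measureReal_def, EuclideanSpace.volume_closedBall_fin_two, ENNReal.toReal_mul, ENNReal.toReal_pow,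
    ENNReal.toReal_ofReal hr, ENNReal.toReal_ofReal Real.pi_pos.le, mul_comm]

theorem Params.volumeReal_union (p : Params) (hδ : 0 < p.δ) {x y : Plane} (h0 : 0 < dist x y) :
    volume.real (Metric.closedBall x p.δ ∪ Metric.closedBall y p.δ) = p.unionArea (dist x y) := by
  have hu := measureReal_union_add_inter (μ := volume) (s := Metric.closedBall x p.δ)
    (t := Metric.closedBall y p.δ) Metric.isClosed_closedBall.measurableSet
    measure_closedBall_lt_top.ne measure_closedBall_lt_top.ne
  rw [Plane.volumeReal_closedBall x hδ.le, Plane.volumeReal_closedBall y hδ.le] at hu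
  rw [Params.unionArea]
  split_ifs with h
  · have hi := Plane.volume_inter_closedBall hδ h0 h
    have : volume.real (Metric.closedBall x p.δ ∩ Metric.closedBall y p.δ) =
        2 * p.δ ^ 2 * Real.arccos (dist x y / (2 * p.δ)) -
        dist x y * Real.sqrt (p.δ ^ 2 - dist x y ^ 2 / 4) := by
      rw [measureReal_def, hi, ENNReal.toReal_ofReal]
      -- The integral is half the lens area, so that expression is nonnegative and `ENNReal.ofReal`
      -- does not truncate it.
      have := integral_sqrt_sq_sub_sq (d := dist x y / 2) (by positivity) (by linarith) hδ
      have h3 : 0 ≤ ∫ t in (dist x y / 2)..p.δ, 2 * Real.sqrt (p.δ ^ 2 - t ^ 2) :=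
        intervalIntegral.integral_nonneg (by linarith) fun t _ => by positivity
      rw [this, show dist x y / 2 / p.δ = dist x y / (2 * p.δ) by field_simp,
        show (dist x y / 2) ^ 2 = dist x y ^ 2 / 4 by ring] at h3
      linarith
    linarith
  · have : volume.real (Metric.closedBall x p.δ ∩ Metric.closedBall y p.δ) = 0 := by
      -- Disks with centres at least `2 * p.δ` apart can meet only on their boundary circles, which
      -- are null sets.
      rw [measureReal_def, measure_mono_null (t := Metric.sphere x p.δ), ENNReal.toReal_zero]
      · intro z hz
        have h1 := hz.1
        have h2 := hz.2
        rw [Metric.mem_closedBall] at h1 h2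
        rw [Metric.mem_sphere]
        have := dist_triangle_left x y z
        linarith
      · exact Measure.addHaar_sphere_of_ne_zero _ _ hδ.ne'
    linarith

end

/-! ### Localization to small cells and the first moment of the hard-core process. -/

section

open Filter Topology

theorem exists_measurable_partition_ball {X : Type*} [PseudoMetricSpace X] [TopologicalSpace.SeparableSpace X]
    [Nonempty X] [MeasurableSpace X] [OpensMeasurableSpace X] {ε : ℝ} (hε : 0 < ε) :
    ∃ (c : ℕ → X) (C : ℕ → Set X), (∀ a, MeasurableSet (C a)) ∧ Pairwise (Function.onFun Disjoint C) ∧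
      ⋃ a, C a = univ ∧ ∀ a, C a ⊆ Metric.ball (c a) ε := by
  let f : ℕ → Set X := fun n => Metric.ball (TopologicalSpace.denseSeq X n) ε
  refine ⟨TopologicalSpace.denseSeq X, disjointed f, ?_, disjoint_disjointed f, ?_, disjointed_subset f⟩
  · exact MeasurableSet.disjointed fun n => Metric.isOpen_ball.measurableSet
  · rw [iUnion_disjointed]
    refine eq_univ_of_forall fun z => ?_
    obtain ⟨n, hn⟩ := (TopologicalSpace.denseRange_denseSeq X).exists_dist_lt z hε
    exact mem_iUnion.2 ⟨n, hn⟩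

/-- Comparison of measures on a product from their values on small rectangles. -/
theorem lintegral_le_of_small_rectangles {X : Type*} [PseudoMetricSpace X] [TopologicalSpace.SeparableSpace X]
    [Nonempty X] [MeasurableSpace X] [OpensMeasurableSpace X]
    {μ ν : Measure (X × X)} {H : X × X → ℝ≥0∞} (hH : LowerSemicontinuous H) {c : ℕ → ℝ≥0∞} {ε : ℕ → ℝ}
    (hε : ∀ n, 0 < ε n) (hε0 : Tendsto ε atTop (𝓝 0)) (hc : Tendsto c atTop (𝓝 1))
    (hsmall : ∀ n a b A B, MeasurableSet A → MeasurableSet B → A ⊆ Metric.ball a (ε n) →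
      B ⊆ Metric.ball b (ε n) → (∀ y ∈ Metric.ball a (ε n), ∀ z ∈ Metric.ball b (ε n), H (y, z) ≠ 0) →
      μ (A ×ˢ B) ≤ c n * ν (A ×ˢ B)) :
    ∫⁻ p, H p ∂μ ≤ ∫⁻ p, H p ∂ν := by
  choose d C hCm hCd hCu hCb using fun n => exists_measurable_partition_ball (X := X) (hε n)
  let R (n : ℕ) (q : ℕ × ℕ) : Set (X × X) := C n q.1 ×ˢ C n q.2
  have hRm (n : ℕ) (q : ℕ × ℕ) : MeasurableSet (R n q) := (hCm n _).prod (hCm n _)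
  have hRd (n : ℕ) : Pairwise (Function.onFun Disjoint (R n)) := by
    intro q q' hq
    simp only [Function.onFun, R, Set.disjoint_prod]
    by_contra! hcon
    refine hq (Prod.ext ?_ ?_)
    · by_contra hne; exact hcon.1 (hCd n hne)
    · by_contra hne; exact hcon.2 (hCd n hne)
  -- The step function `g n` takes on each cell the infimum of `H` over the surrounding product of
  -- balls, so it lies below `H`.
  let G (n : ℕ) (q : ℕ × ℕ) : ℝ≥0∞ :=
    ⨅ y ∈ Metric.ball (d n q.1) (ε n), ⨅ z ∈ Metric.ball (d n q.2) (ε n), H (y, z)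
  have hG (n : ℕ) (q : ℕ × ℕ) {y z : X} (hy : y ∈ Metric.ball (d n q.1) (ε n))
      (hz : z ∈ Metric.ball (d n q.2) (ε n)) : G n q ≤ H (y, z) :=
    (iInf₂_le y hy).trans (iInf₂_le z hz)
  let g (n : ℕ) (p : X × X) : ℝ≥0∞ := ∑' q : ℕ × ℕ, (R n q).indicator (fun _ => G n q) p
  have hgm (n : ℕ) : Measurable (g n) :=
    Measurable.tsum fun q => measurable_const.indicator (hRm n q)
  have hint (n : ℕ) (ρ : Measure (X × X)) : ∫⁻ p, g n p ∂ρ = ∑' q : ℕ × ℕ, G n q * ρ (R n q) := by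
    rw [lintegral_tsum fun q => (measurable_const.indicator (hRm n q)).aemeasurable]
    refine tsum_congr fun q => ?_
    rw [lintegral_indicator (hRm n q), setLIntegral_const]
  -- Lower semicontinuity keeps the infima over shrinking balls above any value less than `H p`;
  -- Fatou's lemma then passes the estimate to `H`.
  have hlim (p : X × X) : H p ≤ liminf (fun n => g n p) atTop := by
    refine le_of_forall_lt fun y hy => ?_
    obtain ⟨y', hy1, hy2⟩ := exists_between hy
    refine hy1.trans_le (le_liminf_of_le (by isBoundedDefault) ?_)
    obtain ⟨r, hr, hball⟩ := Metric.eventually_nhds_iff.1 (hH p y' hy2)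
    filter_upwards [hε0.eventually_lt_const (half_pos hr)] with n hn
    obtain ⟨a, ha⟩ := mem_iUnion.1 ((hCu n).symm ▸ mem_univ p.1)
    obtain ⟨b, hb⟩ := mem_iUnion.1 ((hCu n).symm ▸ mem_univ p.2)
    have h1 : y' ≤ G n (a, b) := by
      refine le_iInf₂ fun y hy => le_iInf₂ fun z hz => (hball ?_).le
      have ha' := Metric.mem_ball.1 (hCb n a ha)
      have hb' := Metric.mem_ball.1 (hCb n b hb)
      rw [Prod.dist_eq, max_lt_iff]
      have t1 := dist_triangle_right y p.1 (d n a)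
      have t2 := dist_triangle_right z p.2 (d n b)
      have hy := Metric.mem_ball.1 hy
      have hz := Metric.mem_ball.1 hz
      constructor <;> simp only <;> linarith
    refine h1.trans (le_trans ?_ (ENNReal.le_tsum (a, b)))
    rw [indicator_of_mem]
    exact ⟨ha, hb⟩
  have hbound (n : ℕ) : ∫⁻ p, g n p ∂μ ≤ c n * ∫⁻ p, H p ∂ν := by
    have h1 : ∑' q : ℕ × ℕ, G n q * ν (R n q) ≤ ∫⁻ p, H p ∂ν := by
      calc ∑' q : ℕ × ℕ, G n q * ν (R n q) ≤ ∑' q : ℕ × ℕ, ∫⁻ p in R n q, H p ∂ν := by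
            refine ENNReal.tsum_le_tsum fun q => ?_
            rw [← setLIntegral_const]
            exact setLIntegral_mono' (hRm n q) fun p hp => hG n q (hCb n _ hp.1) (hCb n _ hp.2)
        _ = ∫⁻ p in ⋃ q, R n q, H p ∂ν := (lintegral_iUnion (hRm n) (hRd n) _).symm
        _ ≤ ∫⁻ p, H p ∂ν := setLIntegral_le_lintegral _ _
    rw [hint]
    refine le_trans ?_ (mul_le_mul_right h1 (c n))
    rw [← ENNReal.tsum_mul_left]
    refine ENNReal.tsum_le_tsum fun q => ?_
    -- Cells with zero infimum contribute nothing. On the others `H` has no zero on the product of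
    -- balls, which is the condition in `hsmall`.
    rcases eq_or_ne (G n q) 0 with h0 | h0
    · simp [h0]
    · rw [mul_left_comm]
      refine mul_le_mul_right (hsmall n _ _ _ _ (hCm n _) (hCm n _) (hCb n _) (hCb n _) ?_) (G n q)
      intro y hy z hz h
      exact h0 (le_antisymm ((hG n q hy hz).trans h.le) bot_le)
  calc ∫⁻ p, H p ∂μ ≤ ∫⁻ p, liminf (fun n => g n p) atTop ∂μ := lintegral_mono hlim
    _ ≤ liminf (fun n => ∫⁻ p, g n p ∂μ) atTop := lintegral_liminf_le hgm
    _ ≤ liminf (fun n => c n * ∫⁻ p, H p ∂ν) atTop := liminf_le_liminf (.of_forall hbound)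
    _ = ∫⁻ p, H p ∂ν := by
      have := ENNReal.Tendsto.mul_const (b := ∫⁻ p, H p ∂ν) hc (Or.inl one_ne_zero)
      rw [one_mul] at this
      exact this.liminf_eq

theorem IsActive.measurableSet {Ω : Type*} [MeasurableSpace Ω] {x : ℕ → Ω → Plane} {Phi : ℕ → Ω → ℝ}
    (hx : ∀ i, Measurable (x i)) (hPhi : ∀ i, Measurable (Phi i)) (δ : ℝ) (i : ℕ) :
    MeasurableSet {w | IsActive x Phi δ w i} := by
  simp only [IsActive]
  rw [Set.ofPred_forall]
  refine MeasurableSet.iInter fun j => ?_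
  by_cases hj : j = i
  · simp [hj]
  · simp only [ne_eq, hj, not_false_eq_true, true_imp_iff]
    simp_rw [imp_iff_not_or]
    exact ((measurableSet_le ((hx j).dist (hx i))
      measurable_const).compl).union (measurableSet_lt (hPhi j) (hPhi i))

namespace IsMarkedPoisson

variable {Ω : Type*} [MeasurableSpace Ω]
variable {x : ℕ → Ω → Plane} {Phi : ℕ → Ω → ℝ} {lam : ℝ} {P : Measure Ω}

theorem measurableSet_isActive (h : IsMarkedPoisson x Phi lam P) (δ : ℝ) (i : ℕ) :
    MeasurableSet {w | IsActive x Phi δ w i} :=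
  IsActive.measurableSet h.poisson.measurable h.marks.measurable δ i

/-- A point of `A` has its disk of radius `δ` inside the fixed disk of radius `δ + ε` around `c`, so
having the largest mark there forces it to be active. -/
theorem measure_active_small_ge [IsProbabilityMeasure P] (h : IsMarkedPoisson x Phi lam P) (hl : 0 < lam)
    {δ ε : ℝ} (hδ : 0 < δ) (hε : 0 < ε) {A : Set Plane} (hA : MeasurableSet A) {c : Plane}
    (hc : A ⊆ Metric.ball c ε) :
    ENNReal.ofReal (lam * ((1 - Real.exp (-(lam * (Real.pi * (δ + ε) ^ 2)))) / (lam * (Real.pi * (δ + ε) ^ 2)))) *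
      volume A ≤ ∑' i, P {w | x i w ∈ A ∧ IsActive x Phi δ w i} := by
  have hv : volume (Metric.closedBall c (δ + ε)) ≠ ∞ := measure_closedBall_lt_top.ne
  have hAB : A ⊆ Metric.closedBall c (δ + ε) :=
    hc.trans (Metric.ball_subset_closedBall.trans (Metric.closedBall_subset_closedBall (by linarith)))
  have key := h.tsum_measure_dominates hl.le hA Metric.isClosed_closedBall.measurableSet hAB hv
  have hvA : volume A ≠ ∞ := measure_ne_top_of_subset hAB hv
  have hne : lam * (Real.pi * (δ + ε) ^ 2) ≠ 0 := by positivity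
  rw [Plane.volumeReal_closedBall c (by positivity), lintegral_exp_neg_mul_one_sub hne,
    ENNReal.ofReal_mul hl.le, ofReal_measureReal hvA] at key
  calc _ = _ := by
        rw [ENNReal.ofReal_mul hl.le, mul_right_comm]
    _ = _ := key.symm
    _ ≤ _ := by
        refine ENNReal.tsum_le_tsum fun i => measure_mono fun w hw => ⟨hw.1, fun j hj hd => hw.2 j hj ?_⟩
        have := Metric.mem_ball.1 (hc hw.1)
        exact Metric.mem_closedBall.2 ((dist_triangle _ (x i w) _).trans (by linarith))

/-- The mean number of active points in `S` is at least `ζ⁽¹⁾ |S|`. -/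
theorem mean_active_ge [IsProbabilityMeasure P] (h : IsMarkedPoisson x Phi lam P) (hl : 0 < lam)
    {δ : ℝ} (hδ : 0 < δ) {S : Set Plane} (hS : MeasurableSet S) (hS1 : volume S ≠ ∞) :
    ENNReal.ofReal ((1 - Real.exp (-(lam * Real.pi * δ ^ 2))) / (Real.pi * δ ^ 2)) * volume S ≤
      ∑' i, P {w | x i w ∈ S ∧ IsActive x Phi δ w i} := by
  -- Lower bound per unit area from cells of radius `ε`; its value at `ε = 0` is ζ⁽¹⁾.
  let F : ℝ → ℝ := fun ε =>
    lam * ((1 - Real.exp (-(lam * (Real.pi * (δ + ε) ^ 2)))) / (lam * (Real.pi * (δ + ε) ^ 2)))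
  have hF : ContinuousAt F 0 := by
    refine ContinuousAt.mul continuousAt_const (ContinuousAt.div (by fun_prop) (by fun_prop) ?_)
    rw [add_zero]; positivity
  have hF0 : F 0 = (1 - Real.exp (-(lam * Real.pi * δ ^ 2))) / (Real.pi * δ ^ 2) := by
    simp only [F, add_zero]
    rw [show lam * (Real.pi * δ ^ 2) = lam * Real.pi * δ ^ 2 by ring]
    field_simp
  have hlim : Tendsto (fun ε => ENNReal.ofReal (F ε) * volume S) (𝓝[>] 0)
      (𝓝 (ENNReal.ofReal (F 0) * volume S)) :=
    ENNReal.Tendsto.mul_const (ENNReal.tendsto_ofReal (hF.tendsto.mono_left nhdsWithin_le_nhds))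
      (Or.inr hS1)
  rw [← hF0]
  refine le_of_tendsto hlim ?_
  filter_upwards [self_mem_nhdsWithin] with ε hε
  obtain ⟨c, C, hCm, hCd, hCu, hCb⟩ := exists_measurable_partition_ball (X := Plane) hε
  have hS' : S = ⋃ a, S ∩ C a := by rw [← inter_iUnion, hCu, inter_univ]
  have hd : Pairwise (Function.onFun Disjoint fun a => S ∩ C a) := fun a b hab =>
    (hCd hab).mono inter_subset_right inter_subset_right
  have hsum (i : ℕ) : P {w | x i w ∈ S ∧ IsActive x Phi δ w i} =
      ∑' a, P {w | x i w ∈ S ∩ C a ∧ IsActive x Phi δ w i} := by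
    rw [← measure_iUnion]
    · congr 1
      ext w
      simp only [mem_ofPred_eq, mem_iUnion, exists_and_right]
      conv_lhs => rw [hS']
      simp
    · intro a b hab
      exact Set.disjoint_left.2 fun w h1 h2 => Set.disjoint_left.1 (hd hab) h1.1 h2.1
    · exact fun a => (h.poisson.measurable i (hS.inter (hCm a))).inter (h.measurableSet_isActive δ i)
  simp_rw [hsum]
  rw [ENNReal.tsum_comm]
  conv_lhs => rw [hS', measure_iUnion hd fun a => hS.inter (hCm a), ← ENNReal.tsum_mul_left]
  exact ENNReal.tsum_le_tsum fun a =>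
    h.measure_active_small_ge hl hδ hε (hS.inter (hCm a)) (inter_subset_right.trans (hCb a))

/-- Bounds the mean number of active cells by a finite quantity; the differentiated generating
function at `t = 1` is the mean. -/
theorem mean_points [IsProbabilityMeasure P] (h : IsMarkedPoisson x Phi lam P) (hl : 0 ≤ lam)
    {S : Set Plane} (hS : MeasurableSet S) (hS1 : volume S ≠ ∞) :
    ∑' i, P {w | x i w ∈ S} = ENNReal.ofReal (lam * volume.real S) := by
  classical
  have h1 (i : ℕ) : P {w | x i w ∈ S} = ∫⁻ w, if x i w ∈ S then 1 else 0 ∂P := by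
    have := lintegral_indicator_one (μ := P) (h.poisson.measurable i hS)
    exact this.symm.trans (lintegral_congr fun w => by simp [indicator])
  simp_rw [h1]
  rw [← lintegral_tsum fun i => (Measurable.ite (h.poisson.measurable i hS) measurable_const
    measurable_const).aemeasurable]
  have := h.poisson.lintegral_mul_pow_pointNum hl hS hS1 (t := 1) zero_le_one
  simp only [ENNReal.ofReal_one, one_pow, mul_one, sub_self, mul_zero, neg_zero, Real.exp_zero] at this
  rw [← this]
  refine lintegral_congr_ae ?_
  filter_upwards [h.poisson.ae_finite hl hS hS1] with w hw
  rw [tsum_ite_mem_eq_pointNum hw, mul_one]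

end IsMarkedPoisson

end

/-! ### The pair density and local bounds for active pairs. -/

section

open Filter Topology

/-- A small ball around `y` misses the disk around `x` but lies in the disk around `y`. This
supplies the condition `D < V` of `pairKernel_eq`. -/
theorem Params.unionArea_gt (p : Params) (hδ : 0 < p.δ) {x y : Plane} (h : p.δ < dist x y) :
    Real.pi * p.δ ^ 2 < p.unionArea (dist x y) := by
  rw [← p.volumeReal_union hδ (hδ.trans h), ← Plane.volumeReal_closedBall x hδ.le]
  set ρ := min p.δ (dist x y - p.δ) with hρ
  have hρ0 : 0 < ρ := lt_min hδ (sub_pos.2 h)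
  have hdis : Disjoint (Metric.closedBall x p.δ) (Metric.ball y ρ) := by
    refine Set.disjoint_left.2 fun z h1 h2 => ?_
    rw [Metric.mem_closedBall] at h1
    rw [Metric.mem_ball] at h2
    have := dist_triangle_left x y z
    have := min_le_right p.δ (dist x y - p.δ)
    linarith
  have hlt : volume.real (Metric.closedBall x p.δ) <
      volume.real (Metric.closedBall x p.δ ∪ Metric.ball y ρ) := by
    rw [measureReal_union hdis Metric.isOpen_ball.measurableSet measure_closedBall_lt_top.ne
      measure_ball_lt_top.ne]
    have : 0 < volume.real (Metric.ball y ρ) :=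
      ENNReal.toReal_pos (Metric.measure_ball_pos _ _ hρ0).ne' measure_ball_lt_top.ne
    linarith
  refine hlt.trans_le (measureReal_mono (union_subset_union_right _ ?_)
    (measure_union_lt_top measure_closedBall_lt_top measure_closedBall_lt_top).ne)
  exact Metric.ball_subset_closedBall.trans (Metric.closedBall_subset_closedBall (min_le_left _ _))

theorem Params.ofReal_zeta2 (p : Params) (hl : 0 < p.lam) (hδ : 0 < p.δ) {x y : Plane}
    (h : p.δ < dist x y) :
    ENNReal.ofReal (p.zeta2 (dist x y)) =
      ENNReal.ofReal (p.lam ^ 2) * pairKernel p.lam (Real.pi * p.δ ^ 2) (p.unionArea (dist x y)) := by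
  have hV := p.unionArea_gt hδ h
  rw [pairKernel_eq hl (by positivity) hV, ← ENNReal.ofReal_mul (by positivity), Params.zeta2,
    Params.retention, if_pos h]
  congr 3
  · rw [mul_assoc p.lam Real.pi]; ring
  · ring

theorem Params.zeta2_of_le (p : Params) {r : ℝ} (h : r ≤ p.δ) : p.zeta2 r = 0 := by
  rw [Params.zeta2, Params.retention, if_neg h.not_gt, mul_zero]

theorem Params.measurable_zeta2 (p : Params) : Measurable p.zeta2 := by
  have hU : Measurable p.unionArea := by
    have := Real.measurable_arccos
    exact Measurable.ite (measurableSet_lt measurable_id measurable_const) (by fun_prop) (by fun_prop)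
  have hR : Measurable p.retention :=
    Measurable.ite (measurableSet_lt measurable_const measurable_id) (by fun_prop) (by fun_prop)
  exact hR.const_mul _

theorem Plane.closedBall_sdiff_le {δ ε : ℝ} (hε : ε ≤ δ) {x a : Plane} (h : dist x a ≤ ε) (hε0 : 0 ≤ ε) :
    volume.real (Metric.closedBall x δ \ Metric.closedBall a (δ - ε)) =
      Real.pi * δ ^ 2 - Real.pi * (δ - ε) ^ 2 := by
  have hsub : Metric.closedBall a (δ - ε) ⊆ Metric.closedBall x δ :=
    Metric.closedBall_subset_closedBall' (by rw [dist_comm]; linarith)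
  rw [measureReal_sdiff hsub Metric.isClosed_closedBall.measurableSet measure_closedBall_lt_top.ne,
    Plane.volumeReal_closedBall _ (hε0.trans hε), Plane.volumeReal_closedBall _ (by linarith)]

/-- The density of the second factorial moment measure of the hard-core process. -/
noncomputable def Params.pairDensity (p : Params) (q : Plane × Plane) : ℝ≥0∞ :=
  ENNReal.ofReal (p.zeta2 (dist q.1 q.2))

theorem Params.measurable_pairDensity (p : Params) : Measurable p.pairDensity :=
  (p.measurable_zeta2.comp (measurable_fst.dist measurable_snd)).ennreal_ofReal

namespace IsMarkedPoisson

variable {Ω : Type*} [MeasurableSpace Ω]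
variable {x : ℕ → Ω → Plane} {Phi : ℕ → Ω → ℝ} {P : Measure Ω}

/-- The fixed disk of radius `δ - ε` lies inside the moving disk of radius `δ`, so an active point
has the largest mark in it: an upper bound. The separation `hfar` keeps each cell outside the other
cell's disk. -/
theorem tsum_measure_active_pair_le [IsProbabilityMeasure P] {lam : ℝ} (h : IsMarkedPoisson x Phi lam P) (hl : 0 ≤ lam)
    {δ ε : ℝ} (hε : 0 < ε) (hεδ : ε ≤ δ / 2) {a b : Plane}
    (hfar : ∀ y ∈ Metric.ball a ε, ∀ z ∈ Metric.ball b ε, δ < dist y z)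
    {A A' : Set Plane} (hA : MeasurableSet A) (hA' : MeasurableSet A')
    (ha : A ⊆ Metric.ball a ε) (hb : A' ⊆ Metric.ball b ε) :
    ∑' i, ∑' u, P {w | (x i w ∈ A ∧ x u w ∈ A') ∧ IsActive x Phi δ w i ∧ IsActive x Phi δ w u} ≤
      ENNReal.ofReal (lam ^ 2) * (volume A * volume A') *
        pairKernel lam (Real.pi * (δ - ε) ^ 2)
          (volume.real (Metric.closedBall a (δ - ε) ∪ Metric.closedBall b (δ - ε))) := by
  set B := Metric.closedBall a (δ - ε) with hB
  set B' := Metric.closedBall b (δ - ε) with hB'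
  have hBm : MeasurableSet B := Metric.isClosed_closedBall.measurableSet
  have hBm' : MeasurableSet B' := Metric.isClosed_closedBall.measurableSet
  have hBv : volume B ≠ ∞ := measure_closedBall_lt_top.ne
  have hBv' : volume B' ≠ ∞ := measure_closedBall_lt_top.ne
  have hAB : A ⊆ B \ B' := fun y hy => by
    have h1 := hfar y (ha hy) b (Metric.mem_ball_self hε)
    have h2 := Metric.mem_ball.1 (ha hy)
    refine ⟨Metric.mem_closedBall.2 (by linarith), fun h3 => ?_⟩
    have := Metric.mem_closedBall.1 h3
    linarith
  have hAB' : A' ⊆ B' \ B := fun y hy => by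
    have h1 := hfar a (Metric.mem_ball_self hε) y (hb hy)
    have h2 := Metric.mem_ball.1 (hb hy)
    refine ⟨Metric.mem_closedBall.2 (by linarith), fun h3 => ?_⟩
    have := Metric.mem_closedBall.1 h3
    rw [dist_comm] at h1
    linarith
  have hvA : volume A ≠ ∞ := measure_ne_top_of_subset (hAB.trans sdiff_subset) hBv
  have hvA' : volume A' ≠ ∞ := measure_ne_top_of_subset (hAB'.trans sdiff_subset) hBv'
  have key := h.tsum_measure_two_dominate hl hA hA' hBm hBm' hAB hAB' hBv hBv'
  refine (ENNReal.tsum_le_tsum fun i => ENNReal.tsum_le_tsum fun u => measure_mono ?_).trans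
    (key.le.trans (le_of_eq ?_))
  · rintro w ⟨⟨h1, h2⟩, h3, h4⟩
    refine ⟨⟨h1, h2⟩, fun j hj hd => h3 j hj ?_, fun j hj hd => h4 j hj ?_⟩
    · have d1 := Metric.mem_ball.1 (ha h1)
      have d2 := Metric.mem_closedBall.1 hd
      have := dist_triangle_right (x j w) (x i w) a
      linarith
    · have d1 := Metric.mem_ball.1 (hb h2)
      have d2 := Metric.mem_closedBall.1 hd
      have := dist_triangle_right (x j w) (x u w) b
      linarith
  · rw [ENNReal.ofReal_mul hl, ENNReal.ofReal_mul hl, ofReal_measureReal hvA, ofReal_measureReal hvA',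
      ENNReal.ofReal_pow hl]
    have hk : ∫⁻ s in Icc (0 : ℝ) 1, ∫⁻ t in Icc (0 : ℝ) 1,
          ENNReal.ofReal (Real.exp (-(lam * (volume.real (B \ B') * (1 - s) +
            volume.real (B' \ B) * (1 - t) + volume.real (B ∩ B') * (1 - min s t))))) =
        pairKernel lam (Real.pi * (δ - ε) ^ 2) (volume.real (B ∪ B')) := by
      rw [pairKernel]
      refine lintegral_congr fun s => lintegral_congr fun t => ?_
      congr 4
      have e1 := measureReal_sdiff_add_inter (μ := volume) (s := B) (t := B') hBm' hBv
      have e2 := measureReal_sdiff_add_inter (μ := volume) (s := B') (t := B) hBm hBv'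
      have e3 := measureReal_union_add_inter (μ := volume) (s := B) (t := B') hBm' hBv hBv'
      have e4 : volume.real B = Real.pi * (δ - ε) ^ 2 := Plane.volumeReal_closedBall _ (by linarith)
      have e5 : volume.real B' = Real.pi * (δ - ε) ^ 2 := Plane.volumeReal_closedBall _ (by linarith)
      rw [inter_comm B' B] at e2
      have f1 : volume.real (B \ B') = Real.pi * (δ - ε) ^ 2 - volume.real (B ∩ B') := by linarith
      have f2 : volume.real (B' \ B) = Real.pi * (δ - ε) ^ 2 - volume.real (B ∩ B') := by linarith
      have f3 : volume.real (B ∪ B') = 2 * (Real.pi * (δ - ε) ^ 2) - volume.real (B ∩ B') := by linarith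
      rw [f1, f2, f3]
      -- With equal disk areas D and union area V, the private regions have area V - D and the
      -- common one 2D - V; regrouping by the order of the marks gives the exponent of `pairKernel`.
      rcases le_total s t with hst | hst
      · rw [min_eq_left hst, max_eq_right hst, abs_of_nonneg (sub_nonneg.2 hst)]; ring
      · rw [min_eq_right hst, max_eq_left hst, abs_of_nonpos (sub_nonpos.2 hst)]; ring
    rw [hk]
    ring

variable {p : Params}

/-- Passing from the disk of radius `p.δ - ε` around a cell centre to the disk of radius `p.δ`
around a nearby point adds an annular area `k`, and to the union of two such disks at most `2 * k`.
-/
theorem pairKernel_small_le (hl : 0 ≤ p.lam) (hδ : 0 < p.δ) {ε : ℝ} (hε : 0 < ε) (hεδ : ε ≤ p.δ / 2)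
    {a b y z : Plane} (hy : y ∈ Metric.ball a ε) (hz : z ∈ Metric.ball b ε) (hyz : 0 < dist y z) :
    pairKernel p.lam (Real.pi * (p.δ - ε) ^ 2)
        (volume.real (Metric.closedBall a (p.δ - ε) ∪ Metric.closedBall b (p.δ - ε))) ≤
      ENNReal.ofReal (Real.exp (2 * p.lam * (Real.pi * p.δ ^ 2 - Real.pi * (p.δ - ε) ^ 2))) *
        pairKernel p.lam (Real.pi * p.δ ^ 2) (p.unionArea (dist y z)) := by
  refine pairKernel_le hl ?_ (by linarith) ?_
  · have : (p.δ - ε) ^ 2 ≤ p.δ ^ 2 := by nlinarith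
    nlinarith [Real.pi_pos]
  · rw [← p.volumeReal_union hδ hyz]
    have h1 := Plane.closedBall_sdiff_le (δ := p.δ) (by linarith) (Metric.mem_ball.1 hy).le hε.le
    have h2 := Plane.closedBall_sdiff_le (δ := p.δ) (by linarith) (Metric.mem_ball.1 hz).le hε.le
    set By := Metric.closedBall y p.δ
    set Bz := Metric.closedBall z p.δ
    set Ba := Metric.closedBall a (p.δ - ε)
    set Bb := Metric.closedBall b (p.δ - ε)
    have hf {u : Plane} {r : ℝ} : volume (Metric.closedBall u r) < ∞ := measure_closedBall_lt_top
    have hsub : By ∪ Bz ⊆ (Ba ∪ Bb) ∪ ((By \ Ba) ∪ (Bz \ Bb)) := by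
      intro u hu
      simp only [mem_union, Set.mem_sdiff] at hu ⊢
      tauto
    have h3 : volume.real (By ∪ Bz) ≤ volume.real ((Ba ∪ Bb) ∪ ((By \ Ba) ∪ (Bz \ Bb))) :=
      measureReal_mono hsub (measure_union_lt_top (measure_union_lt_top hf hf) (measure_union_lt_top
        (measure_lt_top_of_subset sdiff_subset hf.ne) (measure_lt_top_of_subset sdiff_subset hf.ne))).ne
    have h4 := measureReal_union_le (μ := volume) (Ba ∪ Bb) ((By \ Ba) ∪ (Bz \ Bb))
    have h5 := measureReal_union_le (μ := volume) (By \ Ba) (Bz \ Bb)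
    linarith

end IsMarkedPoisson

end

/-! ### Upper bound for the second moment measure. -/

section

open Filter Topology
namespace IsMarkedPoisson
variable {Ω : Type*} [MeasurableSpace Ω]
variable {x : ℕ → Ω → Plane} {Phi : ℕ → Ω → ℝ} {P : Measure Ω}
variable {p : Params}
/-- The second moment measure of the active points is at most the one with density `ζ⁽²⁾`. -/
theorem lintegral_active_pair_le [IsProbabilityMeasure P] (h : IsMarkedPoisson x Phi p.lam P) (hl : 0 < p.lam)
    (hδ : 0 < p.δ) {S : Set Plane} (hS : MeasurableSet S)
    {H : Plane × Plane → ℝ≥0∞} (hH : LowerSemicontinuous H) (hH0 : ∀ q, H q ≠ 0 → p.δ < dist q.1 q.2) :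
    ∑' q : ℕ × ℕ, ∫⁻ w in {w | x q.1 w ∈ S ∧ IsActive x Phi p.δ w q.1 ∧ IsActive x Phi p.δ w q.2},
        H (x q.1 w, x q.2 w) ∂P ≤
      ∫⁻ q, H q * p.pairDensity q ∂((volume.restrict S).prod volume) := by
  let D (q : ℕ × ℕ) : Set Ω := {w | x q.1 w ∈ S ∧ IsActive x Phi p.δ w q.1 ∧ IsActive x Phi p.δ w q.2}
  have hD (q : ℕ × ℕ) : MeasurableSet (D q) :=
    (h.poisson.measurable q.1 hS).inter ((h.measurableSet_isActive _ _).inter (h.measurableSet_isActive _ _))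
  -- Pair measure of the active points, first point in `S`. It includes the diagonal pairs, but `H`
  -- vanishes there by `hH0`.
  let μ : Measure (Plane × Plane) :=
    Measure.sum fun q : ℕ × ℕ => (P.restrict (D q)).map (fun w => (x q.1 w, x q.2 w))
  have hxm (q : ℕ × ℕ) : Measurable fun w => (x q.1 w, x q.2 w) :=
    (h.poisson.measurable q.1).prodMk (h.poisson.measurable q.2)
  have e1 : ∑' q : ℕ × ℕ, ∫⁻ w in D q, H (x q.1 w, x q.2 w) ∂P = ∫⁻ q, H q ∂μ := by
    rw [lintegral_sum_measure]
    refine tsum_congr fun q => ?_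
    rw [lintegral_map hH.measurable (hxm q)]
  have e2 : ∫⁻ q, H q * p.pairDensity q ∂((volume.restrict S).prod volume) =
      ∫⁻ q, H q ∂(((volume.restrict S).prod volume).withDensity p.pairDensity) := by
    rw [lintegral_withDensity_eq_lintegral_mul _ p.measurable_pairDensity hH.measurable]
    exact lintegral_congr fun q => mul_comm _ _
  change ∑' q : ℕ × ℕ, ∫⁻ w in D q, H (x q.1 w, x q.2 w) ∂P ≤ _
  rw [e1, e2]
  let ε : ℕ → ℝ := fun n => p.δ / 2 * (1 / ((n : ℝ) + 1))
  have hε (n : ℕ) : 0 < ε n := by positivity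
  have hεδ (n : ℕ) : ε n ≤ p.δ / 2 := by
    change p.δ / 2 * (1 / ((n : ℝ) + 1)) ≤ p.δ / 2
    refine mul_le_of_le_one_right (by positivity) ?_
    rw [div_le_one (by positivity)]
    linarith [n.cast_nonneg (α := ℝ)]
  have hε0 : Tendsto ε atTop (𝓝 0) := by
    have := tendsto_one_div_add_atTop_nhds_zero_nat (𝕜 := ℝ) |>.const_mul (p.δ / 2)
    rwa [mul_zero] at this
  let c : ℕ → ℝ≥0∞ := fun n =>
    ENNReal.ofReal (Real.exp (2 * p.lam * (Real.pi * p.δ ^ 2 - Real.pi * (p.δ - ε n) ^ 2)))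
  have hc : Tendsto c atTop (𝓝 1) := by
    have hcont : Continuous fun e : ℝ =>
        ENNReal.ofReal (Real.exp (2 * p.lam * (Real.pi * p.δ ^ 2 - Real.pi * (p.δ - e) ^ 2))) :=
      ENNReal.continuous_ofReal.comp (by fun_prop)
    have := (hcont.tendsto 0).comp hε0
    rw [sub_zero, sub_self, mul_zero, Real.exp_zero, ENNReal.ofReal_one] at this
    exact this
  refine lintegral_le_of_small_rectangles (X := Plane) hH hε hε0 hc ?_
  intro n a b A A' hA hA' ha hb hne
  -- Non-vanishing of `H` on the product of balls is what separates the two cells by more than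
  -- `p.δ`.
  have hfar : ∀ y ∈ Metric.ball a (ε n), ∀ z ∈ Metric.ball b (ε n), p.δ < dist y z :=
    fun y hy z hz => hH0 (y, z) (hne y hy z hz)
  have hle := h.tsum_measure_active_pair_le hl.le (hε n) (hεδ n) hfar (hA.inter hS) hA'
    (inter_subset_left.trans ha) hb
  have hμ : μ (A ×ˢ A') = ∑' i, ∑' u, P {w | (x i w ∈ A ∩ S ∧ x u w ∈ A') ∧
      IsActive x Phi p.δ w i ∧ IsActive x Phi p.δ w u} := by
    rw [Measure.sum_apply _ (hA.prod hA'), ENNReal.tsum_prod']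
    refine tsum_congr fun i => tsum_congr fun u => ?_
    rw [Measure.map_apply (hxm _) (hA.prod hA'), Measure.restrict_apply ((hxm _) (hA.prod hA'))]
    congr 1
    ext w
    simp only [D, mem_inter_iff, mem_preimage, mem_prod, mem_ofPred_eq]
    tauto
  rw [hμ]
  refine hle.trans ?_
  rw [withDensity_apply _ (hA.prod hA'), ← lintegral_const_mul' _ _ ENNReal.ofReal_ne_top]
  have hprod : volume (A ∩ S) * volume A' = ((volume.restrict S).prod volume) (A ×ˢ A') := by
    rw [Measure.prod_prod, Measure.restrict_apply hA]
  rw [hprod, mul_right_comm, ← setLIntegral_const]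
  refine setLIntegral_mono' (hA.prod hA') ?_
  rintro ⟨y, z⟩ ⟨hy, hz⟩
  have hd := hfar y (ha hy) z (hb hz)
  rw [Params.pairDensity, p.ofReal_zeta2 hl hδ hd, mul_left_comm]
  exact mul_le_mul_right (pairKernel_small_le hl.le hδ (hε n) (hεδ n) (ha hy) (hb hz) (hδ.trans hd)) _

end IsMarkedPoisson

end

/-! ### Convexity of the rate; path loss and shadowing moments. -/

section

open Filter Topology

/-- `1 / w - 1 / (w + a)` is minus the derivative of `log (1 + a / u)` at `u = w`. Applying `log z ≤
z - 1` to the ratio of the two arguments leaves a multiple of `(u - w) ^ 2` with the right sign. -/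
theorem log_div_tangent_le {a u w : ℝ} (ha : 0 < a) (hu : 0 < u) (hw : 0 < w) :
    Real.log (1 + a / w) + (1 / w - 1 / (w + a)) * w ≤
      Real.log (1 + a / u) + (1 / w - 1 / (w + a)) * u := by
  have hua : 0 < u + a := by linarith
  have hwa : 0 < w + a := by linarith
  have e1 : 1 + a / w = (1 + a / u) * (u * (w + a) / (w * (u + a))) := by field_simp
  rw [e1, Real.log_mul (by positivity) (by positivity)]
  have h1 := Real.log_le_sub_one_of_pos (x := u * (w + a) / (w * (u + a))) (by positivity)
  have h2 : u * (w + a) / (w * (u + a)) - 1 ≤ (1 / w - 1 / (w + a)) * (u - w) := by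
    have e2 : u * (w + a) / (w * (u + a)) - 1 = a * (u - w) / (w * (u + a)) := by field_simp; ring
    have e3 : (1 / w - 1 / (w + a)) * (u - w) - a * (u - w) / (w * (u + a)) =
        a * (u - w) ^ 2 / (w * (w + a) * (u + a)) := by field_simp; ring
    rw [e2]
    have : 0 ≤ a * (u - w) ^ 2 / (w * (w + a) * (u + a)) := by positivity
    linarith
  linarith

/-- The slope of `z ↦ log₂ (1 + a / (z + n))` at `J`, up to sign. -/
noncomputable def rateSlope (a J n : ℝ) : ℝ := (1 / (J + n) - 1 / (J + n + a)) / Real.log 2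

theorem rateSlope_pos {a J n : ℝ} (ha : 0 < a) (hJ : 0 ≤ J) (hn : 0 < n) : 0 < rateSlope a J n := by
  have h2 : 0 < Real.log 2 := Real.log_pos one_lt_two
  refine div_pos (sub_pos.2 ?_) h2
  exact one_div_lt_one_div_of_lt (by positivity) (by linarith)

theorem rateSlope_le {a J n : ℝ} (ha : 0 < a) (hJ : 0 ≤ J) (hn : 0 < n) :
    rateSlope a J n ≤ 1 / (J + n) / Real.log 2 := by
  have h2 : 0 < Real.log 2 := Real.log_pos one_lt_two
  refine div_le_div_of_nonneg_right ?_ h2.le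
  have : 0 < 1 / (J + n + a) := by positivity
  linarith

theorem logb_one_add_nonneg {y : ℝ} (hy : 0 ≤ y) : 0 ≤ Real.logb 2 (1 + y) :=
  Real.logb_nonneg one_lt_two (by linarith)

/-- The achievable rate is convex in the interference power, hence above its tangent at `J`. -/
theorem rate_tangent_le {a J n : ℝ} (ha : 0 < a) (hJ : 0 ≤ J) (hn : 0 < n) (I : ℝ≥0∞) :
    ENNReal.ofReal (Real.logb 2 (1 + a / (J + n))) + ENNReal.ofReal (rateSlope a J n) * ENNReal.ofReal J ≤
      ENNReal.ofReal (Real.logb 2 (1 + (ENNReal.ofReal a / (I + ENNReal.ofReal n)).toReal)) +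
        ENNReal.ofReal (rateSlope a J n) * I := by
  have hc := rateSlope_pos ha hJ hn
  -- At infinite interference the rate is 0, but the slope term on the right is `⊤`; writing the
  -- tangent without subtraction covers this case.
  rcases eq_or_ne I ⊤ with rfl | hI
  · rw [ENNReal.mul_top (by simpa using hc)]
    simp
  · obtain ⟨y, hy, rfl⟩ : ∃ y : ℝ, 0 ≤ y ∧ I = ENNReal.ofReal y :=
      ⟨I.toReal, ENNReal.toReal_nonneg, (ENNReal.ofReal_toReal hI).symm⟩
    have h2 : 0 < Real.log 2 := Real.log_pos one_lt_two
    rw [← ENNReal.ofReal_add hy hn.le, ENNReal.toReal_div, ENNReal.toReal_ofReal ha.le,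
      ENNReal.toReal_ofReal (by positivity), ← ENNReal.ofReal_mul hc.le, ← ENNReal.ofReal_mul hc.le,
      ← ENNReal.ofReal_add (logb_one_add_nonneg (by positivity)) (by positivity),
      ← ENNReal.ofReal_add (logb_one_add_nonneg (by positivity)) (by positivity)]
    refine ENNReal.ofReal_le_ofReal ?_
    have key := log_div_tangent_le ha (u := y + n) (w := J + n) (by positivity) (by positivity)
    have e (z : ℝ) : Real.logb 2 (1 + a / (z + n)) + rateSlope a J n * z =
        (Real.log (1 + a / (z + n)) + (1 / (J + n) - 1 / (J + n + a)) * (z + n)) / Real.log 2 -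
          rateSlope a J n * n := by
      rw [rateSlope, Real.logb]; field_simp; ring
    rw [e, e]
    exact sub_le_sub_right (div_le_div_of_nonneg_right key h2.le) _

namespace Params

variable (p : Params)

theorem fading_sq (t r : ℝ) :
    p.fading t r ^ 2 = ENNReal.ofReal (Real.exp (2 / p.b * t)) * (ENNReal.ofReal r ^ (2 * p.α))⁻¹ := by
  rw [fading, ENNReal.div_eq_inv_mul, mul_pow, mul_comm, ← ENNReal.ofReal_pow (Real.exp_pos _).le,
    ← Real.exp_nat_mul, ← ENNReal.inv_pow, ← ENNReal.rpow_natCast (_ ^ p.α), ← ENNReal.rpow_mul]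
  rw [show ((2 : ℕ) : ℝ) * (t / p.b) = 2 / p.b * t by push_cast; ring,
    show p.α * ((2 : ℕ) : ℝ) = 2 * p.α by push_cast; ring]

/-- The squared path loss between a base station at `z` and a user at `v`. -/
noncomputable def pathLoss (v z : Plane) : ℝ≥0∞ := (ENNReal.ofReal ‖z - v‖ ^ (2 * p.α))⁻¹

theorem continuous_pathLoss (v : Plane) : Continuous (p.pathLoss v) :=
  ((ENNReal.continuous_rpow_const).comp (ENNReal.continuous_ofReal.comp (by fun_prop))).inv

open Classical in
/-- The path loss as a function of the positions of two base stations, cut off at distance `δ`. -/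
noncomputable def pairLoss (v : Plane) (q : Plane × Plane) : ℝ≥0∞ :=
  if p.δ < dist q.1 q.2 then p.pathLoss v (q.2 - q.1) else 0

/-- Continuous with values in `[0, ∞]`, pole included, on the open set where the distance exceeds
`p.δ`, and zero elsewhere. -/
theorem lowerSemicontinuous_pairLoss (v : Plane) : LowerSemicontinuous (p.pairLoss v) := by
  intro q y hy
  by_cases hq : p.δ < dist q.1 q.2
  · rw [pairLoss, if_pos hq] at hy
    have hc : Continuous fun q : Plane × Plane => p.pathLoss v (q.2 - q.1) :=
      (p.continuous_pathLoss v).comp (by fun_prop)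
    have hd : Continuous fun q : Plane × Plane => dist q.1 q.2 := by fun_prop
    filter_upwards [hc.continuousAt.eventually_const_lt hy, hd.continuousAt.eventually_const_lt hq]
      with q' h1 h2
    rwa [pairLoss, if_pos h2]
  · rw [pairLoss, if_neg hq] at hy
    exact absurd hy (by simp)

theorem lintegral_pairLoss (v : Plane) (S : Set Plane) :
    ∫⁻ q, p.pairLoss v q * p.pairDensity q ∂((volume.restrict S).prod volume) =
      volume S * p.pairIntegral v := by
  rw [lintegral_prod (fun q => p.pairLoss v q * p.pairDensity q) ((p.lowerSemicontinuous_pairLoss v).measurable.mul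
    p.measurable_pairDensity).aemeasurable]
  have key (y : Plane) : ∫⁻ z, p.pairLoss v (y, z) * p.pairDensity (y, z) = p.pairIntegral v := by
    -- The substitution `z ↦ y - z` turns the displacement from the user into `-(z + v)`. The cutoff
    -- then disappears because ζ⁽²⁾ vanishes up to distance `p.δ`.
    rw [← lintegral_sub_left_eq_self _ y, pairIntegral]
    refine lintegral_congr fun z => ?_
    have hd : dist y (y - z) = ‖z‖ := by rw [dist_eq_norm]; congr 1; abel
    rw [pairLoss, pairDensity, hd]
    split_ifs with h
    · rw [pathLoss, ENNReal.div_eq_inv_mul, sub_sub_cancel_left, ← neg_add', norm_neg]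
    · rw [p.zeta2_of_le (not_lt.1 h)]; simp
  simp_rw [key]
  rw [lintegral_const, Measure.restrict_apply_univ, mul_comm]

/-- The second moment of the shadowing. -/
noncomputable def shadowMoment : ℝ := Real.exp (2 * p.sigmaS ^ 2 / p.b ^ 2)

/-- The law of the shadowing exponents. -/
noncomputable def shadowLaw : Measure ℝ := gaussianReal 0 (Real.toNNReal (p.sigmaS ^ 2))

instance : IsProbabilityMeasure p.shadowLaw := by unfold shadowLaw; infer_instance

/-- Gaussian moment generating function at `2 / p.b`. -/
theorem lintegral_exp_shadow :
    ∫⁻ t, ENNReal.ofReal (Real.exp (2 / p.b * t)) ∂p.shadowLaw = ENNReal.ofReal p.shadowMoment := by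
  have h1 := mgf_gaussianReal (p := p.shadowLaw) (X := id) (μ := 0) (v := Real.toNNReal (p.sigmaS ^ 2))
    (by rw [Measure.map_id]; rfl) (2 / p.b)
  rw [mgf] at h1
  rw [← ofReal_integral_eq_lintegral_ofReal (by
      rw [shadowLaw]; exact integrable_exp_mul_gaussianReal _)
    (.of_forall fun t => (Real.exp_pos _).le)]
  simp only [id] at h1
  rw [h1, shadowMoment, Real.coe_toNNReal _ (sq_nonneg _)]
  congr 2
  ring

end Params

end

/-! ### Equivalent forms of the lower bound. -/

section

open Filter Topology

namespace Params

variable (p : Params)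

theorem gain_pos {p : Params} (hp : p.Positive) : 0 < p.gain := by
  have h1 : (0 : ℝ) < p.M := by exact_mod_cast hp.M
  have h2 := hp.Pf
  have h3 := hp.Pp
  unfold gain
  positivity

theorem zeta1_pos {p : Params} (hp : p.Positive) : 0 < p.zeta1 := by
  have h1 := hp.lam
  have h2 := hp.δ
  refine div_pos (sub_pos.2 (Real.exp_lt_one_iff.2 ?_)) (by positivity)
  have : 0 < p.lam * Real.pi * p.δ ^ 2 := by positivity
  linarith

/-- The power received at distance `‖v‖` with shadowing exponent `t`. -/
noncomputable def signalPower (v : Plane) (t : ℝ) : ℝ :=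
  p.gain * Real.exp (2 / p.b * t) * ‖v‖ ^ (-(2 * p.α))

theorem signalPower_pos {p : Params} (hp : p.Positive) {v : Plane} (hv : v ≠ 0) (t : ℝ) :
    0 < p.signalPower v t := by
  have := gain_pos hp
  have := norm_pos_iff.2 hv
  unfold signalPower
  positivity

/-- The mean interference power in the bound when the shadowing has second moment `m`. -/
noncomputable def meanInterference (v : Plane) (m : ℝ) : ℝ :=
  p.gain * m * (p.pairIntegral v).toReal / p.zeta1

theorem meanInterference_nonneg {p : Params} (hp : p.Positive) (v : Plane) {m : ℝ} (hm : 0 ≤ m) :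
    0 ≤ p.meanInterference v m := by
  have := gain_pos hp
  have := zeta1_pos hp
  unfold meanInterference
  positivity

theorem shadowDensity_nonneg {p : Params} (hp : p.Positive) {ω : ℝ} (hω : 0 < ω) :
    0 ≤ p.shadowDensity ω := by
  have := hp.b
  have := hp.sigmaS
  unfold shadowDensity
  positivity

theorem rateBound_of_pairIntegral_eq_top {p : Params} (hp : p.Positive) (m : ℝ) {v : Plane}
    (h : p.pairIntegral v = ⊤) : p.rateBound m v = 0 := by
  have h1 : ENNReal.ofReal p.gain * ⊤ = ⊤ := ENNReal.mul_top (by simpa using gain_pos hp)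
  simp [rateBound, h, h1]

/-- Multiplying numerator and denominator by `m / p.zeta1` exhibits the bound as the rate at the
deterministic interference level `meanInterference`, the only place where `m` remains. -/
theorem rateBound_eq {p : Params} (hp : p.Positive) {m : ℝ} (hm : 0 < m) {v : Plane}
    (h : p.pairIntegral v ≠ ⊤) :
    p.rateBound m v = ∫⁻ ω in Ioi (0 : ℝ), ENNReal.ofReal (Real.logb 2 (1 +
      p.gain * ω ^ 2 * ‖v‖ ^ (-(2 * p.α)) / (p.meanInterference v m + p.sigmaN ^ 2)) *
        p.shadowDensity ω) := by
  have hg := gain_pos hp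
  have hz := zeta1_pos hp
  have hn := hp.sigmaN
  refine lintegral_congr fun ω => ?_
  congr 4
  have e : ENNReal.ofReal p.gain * p.pairIntegral v =
      ENNReal.ofReal (p.gain * (p.pairIntegral v).toReal) := by
    rw [ENNReal.ofReal_mul hg.le, ENNReal.ofReal_toReal h]
  rw [e, ← ENNReal.ofReal_add (by positivity) (by positivity), ENNReal.toReal_div,
    ENNReal.toReal_ofReal (by positivity), ENNReal.toReal_ofReal (by positivity), meanInterference]
  have hq : 0 ≤ (p.pairIntegral v).toReal := ENNReal.toReal_nonneg
  generalize (p.pairIntegral v).toReal = q at *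
  have h1 : p.gain * q + p.zeta1 * m⁻¹ * p.sigmaN ^ 2 ≠ 0 := by positivity
  have h2 : p.gain * m * q / p.zeta1 + p.sigmaN ^ 2 ≠ 0 := by positivity
  rw [div_eq_div_iff h1 h2]
  field_simp

theorem rateBound_antitone {p : Params} (hp : p.Positive) {m m' : ℝ} (hm : 0 < m) (hmm : m ≤ m') (v : Plane) :
    p.rateBound m' v ≤ p.rateBound m v := by
  rcases eq_or_ne (p.pairIntegral v) ⊤ with h | h
  · rw [rateBound_of_pairIntegral_eq_top hp m' h]; exact bot_le
  · have hg := gain_pos hp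
    have hz := zeta1_pos hp
    have hn := hp.sigmaN
    have hJ := meanInterference_nonneg hp v hm.le
    have hJ' := meanInterference_nonneg hp v (hm.le.trans hmm)
    have hJJ : p.meanInterference v m ≤ p.meanInterference v m' := by
      unfold meanInterference
      gcongr
    rw [rateBound_eq hp hm h, rateBound_eq hp (hm.trans_le hmm) h]
    refine setLIntegral_mono' measurableSet_Ioi fun ω hω => ENNReal.ofReal_le_ofReal ?_
    have hnn : 0 ≤ p.gain * ω ^ 2 * ‖v‖ ^ (-(2 * p.α)) := by positivity
    refine mul_le_mul_of_nonneg_right (Real.logb_le_logb_of_le one_lt_two ?_ ?_) (shadowDensity_nonneg hp hω)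
    · have : 0 ≤ p.gain * ω ^ 2 * ‖v‖ ^ (-(2 * p.α)) / (p.meanInterference v m' + p.sigmaN ^ 2) :=
        div_nonneg hnn (by positivity)
      linarith
    · gcongr

/-- Expectations under the lognormal density. -/
theorem lintegral_mul_shadowDensity {p : Params} (hp : p.Positive) {F : ℝ → ℝ} (hF : Measurable F) :
    ∫⁻ ω in Ioi (0 : ℝ), ENNReal.ofReal (F ω * p.shadowDensity ω) =
      ∫⁻ t, ENNReal.ofReal (F (Real.exp (t / p.b))) ∂p.shadowLaw := by
  have hb := hp.b
  have hs := hp.sigmaS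
  have himg : (fun t : ℝ => Real.exp (t / p.b)) '' univ = Ioi 0 := by
    ext ω
    simp only [image_univ, mem_range, mem_Ioi]
    constructor
    · rintro ⟨t, rfl⟩; exact Real.exp_pos _
    · intro h
      exact ⟨p.b * Real.log ω, by rw [mul_div_cancel_left₀ _ hb.ne', Real.exp_log h]⟩
  have hd (t : ℝ) : HasDerivWithinAt (fun t : ℝ => Real.exp (t / p.b)) (Real.exp (t / p.b) * (1 / p.b)) univ t :=
    (((hasDerivAt_id' t).div_const p.b).exp).hasDerivWithinAt
  have hinj : InjOn (fun t : ℝ => Real.exp (t / p.b)) univ := by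
    intro a _ c _ hac
    have := Real.exp_injective hac
    field_simp at this
    exact this
  have hv : Real.toNNReal (p.sigmaS ^ 2) ≠ 0 := by
    simp only [ne_eq, Real.toNNReal_eq_zero, not_le]; positivity
  -- Substituting `ω = exp (t / p.b)`, the Jacobian `ω / p.b` cancels the prefactor `p.b / ω` of the
  -- lognormal density and leaves the Gaussian one.
  rw [← himg, lintegral_image_eq_lintegral_abs_deriv_mul MeasurableSet.univ (fun t _ => hd t) hinj,
    Measure.restrict_univ, shadowLaw, gaussianReal_of_var_ne_zero _ hv,
    lintegral_withDensity_eq_lintegral_mul _ (measurable_gaussianPDF _ _)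
      (show Measurable fun t => ENNReal.ofReal (F (Real.exp (t / p.b))) from
        (hF.comp (by fun_prop)).ennreal_ofReal)]
  refine lintegral_congr fun t => ?_
  rw [Pi.mul_apply, gaussianPDF, ← ENNReal.ofReal_mul (abs_nonneg _),
    ← ENNReal.ofReal_mul (gaussianPDFReal_nonneg _ _ _)]
  congr 1
  rw [abs_of_pos (by positivity), gaussianPDFReal, shadowDensity, Real.coe_toNNReal _ (sq_nonneg _),
    Real.log_exp, Real.sqrt_mul (by positivity) (p.sigmaS ^ 2), Real.sqrt_sq hs.le]
  rw [show -(t - 0) ^ 2 / (2 * p.sigmaS ^ 2) = -(p.b ^ 2 * (t / p.b) ^ 2 / (2 * p.sigmaS ^ 2)) by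
    field_simp; ring]
  field_simp

theorem rateBound_eq_lintegral_shadowLaw {p : Params} (hp : p.Positive) {m : ℝ} (hm : 0 < m) {v : Plane}
    (h : p.pairIntegral v ≠ ⊤) :
    p.rateBound m v = ∫⁻ t, ENNReal.ofReal (Real.logb 2 (1 +
      p.signalPower v t / (p.meanInterference v m + p.sigmaN ^ 2))) ∂p.shadowLaw := by
  rw [rateBound_eq hp hm h, lintegral_mul_shadowDensity hp
    (F := fun ω => Real.logb 2 (1 + p.gain * ω ^ 2 * ‖v‖ ^ (-(2 * p.α)) /
      (p.meanInterference v m + p.sigmaN ^ 2)))]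
  · refine lintegral_congr fun t => ?_
    rw [signalPower, ← Real.exp_nat_mul, show ((2 : ℕ) : ℝ) * (t / p.b) = 2 / p.b * t by push_cast; ring]
  · simp only [Real.logb]
    fun_prop

variable {Ω : Type*} {K : ℕ} {x : ℕ → Ω → Plane} {Phi : ℕ → Ω → ℝ}
  {s : ℕ → Fin K → ℕ → Ω → ℝ}

theorem signal_eq {p : Params} (hp : p.Positive) {v : Plane} (hv : v ≠ 0) (k : Fin K) (i : ℕ) (w : Ω) :
    p.signal s v k i w = ENNReal.ofReal (p.signalPower v (s i k i w)) := by
  have hg := gain_pos hp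
  have hv' := norm_pos_iff.2 hv
  rw [signal, fading_sq, signalPower, ENNReal.ofReal_mul (by positivity), ENNReal.ofReal_mul hg.le,
    ENNReal.ofReal_rpow_of_pos hv', ← ENNReal.ofReal_inv_of_pos (by positivity), Real.rpow_neg hv'.le,
    mul_assoc]

theorem interference_eq (v : Plane) (k : Fin K) (i : ℕ) (w : Ω) :
    p.interference x Phi s v k i w = ENNReal.ofReal p.gain *
      ∑' u, {w | u ≠ i ∧ IsActive x Phi p.δ w u}.indicator (fun w =>
        ENNReal.ofReal (Real.exp (2 / p.b * s u k i w)) * p.pathLoss v (x u w - x i w)) w := by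
  rw [interference]
  congr 1
  have := tsum_subtype {u : ℕ | u ≠ i ∧ IsActive x Phi p.δ w u} (fun u =>
    p.fading (s u k i w) ‖x u w - x i w - v‖ ^ 2)
  refine this.trans (tsum_congr fun u => ?_)
  simp only [indicator, mem_ofPred_eq, fading_sq, pathLoss]

end Params

end

/-! ### Averaging the tangent inequality over the network. -/

section

namespace IsNetwork

variable {Ω : Type*} [MeasurableSpace Ω] {P : Measure Ω} {p : Params} {K : ℕ}
  {x : ℕ → Ω → Plane} {Phi : ℕ → Ω → ℝ} {s : ℕ → Fin K → ℕ → Ω → ℝ}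

theorem isMarkedPoisson (hN : IsNetwork x Phi s p.lam p.sigmaS P) :
    IsMarkedPoisson x Phi p.lam P where
  poisson := hN.poisson
  marks := ⟨hN.mark_measurable, hN.mark_law, hN.mark_indep⟩
  indep := hN.mark_indep_points

theorem measurableSet_isActive (hN : IsNetwork x Phi s p.lam p.sigmaS P) (i : ℕ) :
    MeasurableSet {w | IsActive x Phi p.δ w i} :=
  IsActive.measurableSet hN.poisson.measurable hN.mark_measurable _ i

theorem measurableSet_activeIn (hN : IsNetwork x Phi s p.lam p.sigmaS P) {S : Set Plane}
    (hS : MeasurableSet S) (i : ℕ) : MeasurableSet {w | x i w ∈ S ∧ IsActive x Phi p.δ w i} :=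
  (hN.poisson.measurable i hS).inter (hN.measurableSet_isActive i)

theorem lintegral_shadow (hN : IsNetwork x Phi s p.lam p.sigmaS P) (u : ℕ) (k : Fin K) (i : ℕ)
    {G : ℝ → ℝ≥0∞} (hG : Measurable G) :
    ∫⁻ w, G (s u k i w) ∂P = ∫⁻ t, G t ∂p.shadowLaw := by
  rw [Params.shadowLaw, ← hN.shadow_law u k i, lintegral_map hG (hN.shadow_measurable u k i)]

/-- Positions and marks are independent of the shadowing. -/
theorem lintegral_config_mul_shadow (hN : IsNetwork x Phi s p.lam p.sigmaS P) (k : Fin K) (i : ℕ)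
    {F : (ℕ → Plane) × (ℕ → ℝ) → ℝ≥0∞} (hF : Measurable F) {G : (ℕ → ℝ) → ℝ≥0∞} (hG : Measurable G) :
    ∫⁻ w, F (fun j => x j w, fun j => Phi j w) * G (fun u => s u k i w) ∂P =
      (∫⁻ w, F (fun j => x j w, fun j => Phi j w) ∂P) * ∫⁻ w, G (fun u => s u k i w) ∂P := by
  have hc : Measurable fun w => ((fun j => x j w, fun j => Phi j w) : (ℕ → Plane) × (ℕ → ℝ)) :=
    (measurable_pi_lambda _ hN.poisson.measurable).prodMk (measurable_pi_lambda _ hN.mark_measurable)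
  have hs : Measurable fun w u => s u k i w := measurable_pi_lambda _ fun u => hN.shadow_measurable u k i
  exact lintegral_mul_eq_lintegral_mul_lintegral_of_indepFun'' (hF.comp hc).aemeasurable
    (hG.comp hs).aemeasurable ((hN.shadow_indep k i).comp hF hG)

theorem measurable_config_isActive (δ : ℝ) (i : ℕ) :
    MeasurableSet {c : (ℕ → Plane) × (ℕ → ℝ) |
      IsActive (fun j (c : (ℕ → Plane) × (ℕ → ℝ)) => c.1 j) (fun j c => c.2 j) δ c i} :=
  IsActive.measurableSet (fun j => by fun_prop) (fun j => by fun_prop) δ i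

/-- Activity is an event of positions and marks alone, hence independent of the shadowing on the
user's own link. -/
theorem setLIntegral_active_shadow (hN : IsNetwork x Phi s p.lam p.sigmaS P) (k : Fin K) (i : ℕ)
    {S : Set Plane} (hS : MeasurableSet S) {G : ℝ → ℝ≥0∞} (hG : Measurable G) :
    ∫⁻ w in {w | x i w ∈ S ∧ IsActive x Phi p.δ w i}, G (s i k i w) ∂P =
      P {w | x i w ∈ S ∧ IsActive x Phi p.δ w i} * ∫⁻ t, G t ∂p.shadowLaw := by
  have hD := hN.measurableSet_activeIn hS i
  let E : Set ((ℕ → Plane) × (ℕ → ℝ)) := {c | c.1 i ∈ S} ∩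
    {c | IsActive (fun j (c : (ℕ → Plane) × (ℕ → ℝ)) => c.1 j) (fun j c => c.2 j) p.δ c i}
  have hE : MeasurableSet E :=
    (((measurable_pi_apply i).comp measurable_fst) hS).inter (measurable_config_isActive _ i)
  have key := hN.lintegral_config_mul_shadow k i (F := E.indicator 1) (measurable_one.indicator hE)
    (G := fun r => G (r i)) (hG.comp (measurable_pi_apply i))
  rw [hN.lintegral_shadow i k i hG] at key
  -- `E` is stated for the coordinate process on configuration space, so its pullback is the
  -- original event definitionally.
  have e (w : Ω) : E.indicator (1 : (ℕ → Plane) × (ℕ → ℝ) → ℝ≥0∞) (fun j => x j w, fun j => Phi j w) =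
      {w | x i w ∈ S ∧ IsActive x Phi p.δ w i}.indicator 1 w := rfl
  simp_rw [e] at key
  rw [lintegral_indicator_one hD] at key
  rw [← key, ← lintegral_indicator hD]
  refine lintegral_congr fun w => ?_
  simp only [indicator]
  split_ifs <;> simp

/-- Two different shadowings on the links to one user are independent. -/
theorem lintegral_shadow_mul_shadow (hN : IsNetwork x Phi s p.lam p.sigmaS P) (k : Fin K) {i u : ℕ}
    (hui : u ≠ i) {G G' : ℝ → ℝ≥0∞} (hG : Measurable G) (hG' : Measurable G') :
    ∫⁻ w, G (s i k i w) * G' (s u k i w) ∂P =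
      (∫⁻ t, G t ∂p.shadowLaw) * ∫⁻ t, G' t ∂p.shadowLaw := by
  rw [← hN.lintegral_shadow i k i hG, ← hN.lintegral_shadow u k i hG']
  exact lintegral_mul_eq_lintegral_mul_lintegral_of_indepFun''
    (hG.comp (hN.shadow_measurable i k i)).aemeasurable
    (hG'.comp (hN.shadow_measurable u k i)).aemeasurable
    (((hN.shadow_iIndep k i).indepFun hui.symm).comp hG hG')

theorem measurable_interference_term (hN : IsNetwork x Phi s p.lam p.sigmaS P) (v : Plane) (k : Fin K)
    (i u : ℕ) : Measurable ({w | u ≠ i ∧ IsActive x Phi p.δ w u}.indicator fun w =>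
      ENNReal.ofReal (Real.exp (2 / p.b * s u k i w)) * p.pathLoss v (x u w - x i w)) := by
  have h1 := hN.poisson.measurable
  have h2 := hN.shadow_measurable u k i
  have h3 := (p.continuous_pathLoss v).measurable.comp ((h1 u).sub (h1 i))
  refine Measurable.indicator (Measurable.mul (by fun_prop) h3) ?_
  exact (MeasurableSet.const _).inter (hN.measurableSet_isActive u)

theorem measurable_interference (hN : IsNetwork x Phi s p.lam p.sigmaS P) (v : Plane) (k : Fin K)
    (i : ℕ) : Measurable (p.interference x Phi s v k i) := by
  simp_rw [funext (p.interference_eq v k i)]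
  exact (Measurable.tsum fun u => hN.measurable_interference_term v k i u).const_mul _

theorem measurable_signalPower (p : Params) (v : Plane) : Measurable (p.signalPower v) := by
  unfold Params.signalPower
  fun_prop

theorem measurable_rate (hN : IsNetwork x Phi s p.lam p.sigmaS P) (hp : p.Positive) {v : Plane}
    (hv : v ≠ 0) (k : Fin K) (i : ℕ) : Measurable (p.rate x Phi s v k i) := by
  have h1 := hN.measurable_interference v k i
  have h2 : Measurable (p.signal s v k i) := by
    simp_rw [funext (Params.signal_eq hp hv k i)]
    exact ((measurable_signalPower p v).comp (hN.shadow_measurable i k i)).ennreal_ofReal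
  unfold Params.rate
  simp only [Real.logb]
  fun_prop

/-- Geometry, own shadowing and interfering shadowing factorise. The cutoff in `pairLoss` costs
nothing, since two active stations are more than `p.δ` apart. -/
theorem setLIntegral_slope_mul_term_le (hN : IsNetwork x Phi s p.lam p.sigmaS P) (v : Plane) (k : Fin K)
    (i u : ℕ) {S : Set Plane} (hS : MeasurableSet S) {G : ℝ → ℝ≥0∞} (hG : Measurable G) :
    ∫⁻ w in {w | x i w ∈ S ∧ IsActive x Phi p.δ w i}, G (s i k i w) *
        {w | u ≠ i ∧ IsActive x Phi p.δ w u}.indicator (fun w =>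
          ENNReal.ofReal (Real.exp (2 / p.b * s u k i w)) * p.pathLoss v (x u w - x i w)) w ∂P ≤
      ((∫⁻ t, G t ∂p.shadowLaw) * ENNReal.ofReal p.shadowMoment) *
        ∫⁻ w in {w | x i w ∈ S ∧ IsActive x Phi p.δ w i ∧ IsActive x Phi p.δ w u},
          p.pairLoss v (x i w, x u w) ∂P := by
  by_cases hui : u = i
  · simp [hui]
  have hD := hN.measurableSet_activeIn hS i
  have hD2 : MeasurableSet {w | x i w ∈ S ∧ IsActive x Phi p.δ w i ∧ IsActive x Phi p.δ w u} :=
    (hN.poisson.measurable i hS).inter ((hN.measurableSet_isActive i).inter (hN.measurableSet_isActive u))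
  let E : Set ((ℕ → Plane) × (ℕ → ℝ)) := {c | c.1 i ∈ S} ∩
    ({c | IsActive (fun j (c : (ℕ → Plane) × (ℕ → ℝ)) => c.1 j) (fun j c => c.2 j) p.δ c i} ∩
    {c | IsActive (fun j (c : (ℕ → Plane) × (ℕ → ℝ)) => c.1 j) (fun j c => c.2 j) p.δ c u})
  have hE : MeasurableSet E :=
    (((measurable_pi_apply i).comp measurable_fst) hS).inter
      ((measurable_config_isActive _ i).inter (measurable_config_isActive _ u))
  have hF : Measurable (E.indicator fun c => p.pairLoss v (c.1 i, c.1 u)) :=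
    ((p.lowerSemicontinuous_pairLoss v).measurable.comp (by fun_prop)).indicator hE
  have he : Measurable fun t => ENNReal.ofReal (Real.exp (2 / p.b * t)) := by fun_prop
  have key := hN.lintegral_config_mul_shadow k i hF
    (G := fun r => G (r i) * ENNReal.ofReal (Real.exp (2 / p.b * r u)))
    ((hG.comp (measurable_pi_apply i)).mul (he.comp (measurable_pi_apply u)))
  rw [hN.lintegral_shadow_mul_shadow k hui hG he, p.lintegral_exp_shadow] at key
  have e (w : Ω) : E.indicator (fun c => p.pairLoss v (c.1 i, c.1 u)) (fun j => x j w, fun j => Phi j w) =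
      {w | x i w ∈ S ∧ IsActive x Phi p.δ w i ∧ IsActive x Phi p.δ w u}.indicator
        (fun w => p.pairLoss v (x i w, x u w)) w := rfl
  simp_rw [e] at key
  rw [← lintegral_indicator hD2, mul_comm, ← key, ← lintegral_indicator hD]
  refine lintegral_mono fun w => ?_
  by_cases h1 : x i w ∈ S ∧ IsActive x Phi p.δ w i
  · by_cases h2 : IsActive x Phi p.δ w u
    · have hfar : p.δ < dist (x i w) (x u w) := by
        by_contra! hle
        have a1 := h1.2 u hui (by rwa [dist_comm])
        have a2 := h2 i (Ne.symm hui) hle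
        exact lt_asymm a1 a2
      rw [indicator_of_mem (show w ∈ {w | x i w ∈ S ∧ IsActive x Phi p.δ w i} from h1),
        indicator_of_mem (show w ∈ {w | u ≠ i ∧ IsActive x Phi p.δ w u} from ⟨hui, h2⟩),
        indicator_of_mem (show w ∈ {w | x i w ∈ S ∧ IsActive x Phi p.δ w i ∧ IsActive x Phi p.δ w u}
          from ⟨h1.1, h1.2, h2⟩), Params.pairLoss, if_pos hfar]
      exact le_of_eq (by ring)
    · rw [indicator_of_mem (show w ∈ {w | x i w ∈ S ∧ IsActive x Phi p.δ w i} from h1),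
        indicator_of_notMem (show w ∉ {w | u ≠ i ∧ IsActive x Phi p.δ w u} from fun h => h2 h.2), mul_zero]
      exact bot_le
  · rw [indicator_of_notMem (show w ∉ {w | x i w ∈ S ∧ IsActive x Phi p.δ w i} from h1)]
    exact bot_le

/-- Mean interference weighted by a function of the shadowing on the useful links. -/
theorem tsum_setLIntegral_slope_mul_interference_le [IsProbabilityMeasure P]
    (hN : IsNetwork x Phi s p.lam p.sigmaS P) (hp : p.Positive) (v : Plane) (k : Fin K)
    {S : Set Plane} (hS : MeasurableSet S) {G : ℝ → ℝ≥0∞} (hG : Measurable G) :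
    ∑' i, ∫⁻ w in {w | x i w ∈ S ∧ IsActive x Phi p.δ w i},
        G (s i k i w) * p.interference x Phi s v k i w ∂P ≤
      ENNReal.ofReal p.gain * (((∫⁻ t, G t ∂p.shadowLaw) * ENNReal.ofReal p.shadowMoment) *
        (volume S * p.pairIntegral v)) := by
  have h1 (i : ℕ) : ∫⁻ w in {w | x i w ∈ S ∧ IsActive x Phi p.δ w i},
        G (s i k i w) * p.interference x Phi s v k i w ∂P =
      ENNReal.ofReal p.gain * ∑' u, ∫⁻ w in {w | x i w ∈ S ∧ IsActive x Phi p.δ w i}, G (s i k i w) *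
        {w | u ≠ i ∧ IsActive x Phi p.δ w u}.indicator (fun w =>
          ENNReal.ofReal (Real.exp (2 / p.b * s u k i w)) * p.pathLoss v (x u w - x i w)) w ∂P := by
    have hm (u : ℕ) : Measurable fun w => G (s i k i w) *
        {w | u ≠ i ∧ IsActive x Phi p.δ w u}.indicator (fun w =>
          ENNReal.ofReal (Real.exp (2 / p.b * s u k i w)) * p.pathLoss v (x u w - x i w)) w :=
      (hG.comp (hN.shadow_measurable i k i)).mul (hN.measurable_interference_term v k i u)
    rw [← lintegral_tsum fun u => (hm u).aemeasurable, ← lintegral_const_mul' _ _ ENNReal.ofReal_ne_top]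
    refine lintegral_congr fun w => ?_
    rw [p.interference_eq, ENNReal.tsum_mul_left, mul_left_comm]
  simp_rw [h1]
  rw [ENNReal.tsum_mul_left]
  refine mul_le_mul_right ?_ _
  have h2 := hN.isMarkedPoisson.lintegral_active_pair_le hp.lam hp.δ hS
    (p.lowerSemicontinuous_pairLoss v) (fun q hq => by
      by_contra h
      exact hq (if_neg h))
  rw [p.lintegral_pairLoss, ENNReal.tsum_prod'] at h2
  refine le_trans ?_ (mul_le_mul_right h2 _)
  rw [← ENNReal.tsum_mul_left]
  refine ENNReal.tsum_le_tsum fun i => ?_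
  rw [← ENNReal.tsum_mul_left]
  exact ENNReal.tsum_le_tsum fun u => hN.setLIntegral_slope_mul_term_le v k i u hS hG

theorem lintegral_encard_activeIn (hN : IsNetwork x Phi s p.lam p.sigmaS P) {S : Set Plane}
    (hS : MeasurableSet S) :
    ∫⁻ w, ((p.activeIn x Phi S w).encard : ℝ≥0∞) ∂P =
      ∑' i, P {w | x i w ∈ S ∧ IsActive x Phi p.δ w i} := by
  have h1 (w : Ω) : ((p.activeIn x Phi S w).encard : ℝ≥0∞) =
      ∑' i, {w | x i w ∈ S ∧ IsActive x Phi p.δ w i}.indicator (1 : Ω → ℝ≥0∞) w := by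
    rw [← ENNReal.tsum_set_one]
    exact tsum_subtype (p.activeIn x Phi S w) fun _ => (1 : ℝ≥0∞)
  simp_rw [h1]
  rw [lintegral_tsum fun i => (measurable_one.indicator (hN.measurableSet_activeIn hS i)).aemeasurable]
  exact tsum_congr fun i => lintegral_indicator_one (hN.measurableSet_activeIn hS i)

theorem lintegral_tsum_rate (hN : IsNetwork x Phi s p.lam p.sigmaS P) (hp : p.Positive) {v : Plane}
    (hv : v ≠ 0) (k : Fin K) {S : Set Plane} (hS : MeasurableSet S) :
    ∫⁻ w, ∑' i : p.activeIn x Phi S w, ENNReal.ofReal (p.rate x Phi s v k i w) ∂P =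
      ∑' i, ∫⁻ w in {w | x i w ∈ S ∧ IsActive x Phi p.δ w i},
        ENNReal.ofReal (p.rate x Phi s v k i w) ∂P := by
  have h1 (w : Ω) : ∑' i : p.activeIn x Phi S w, ENNReal.ofReal (p.rate x Phi s v k i w) =
      ∑' i, {w | x i w ∈ S ∧ IsActive x Phi p.δ w i}.indicator
        (fun w => ENNReal.ofReal (p.rate x Phi s v k i w)) w :=
    tsum_subtype (p.activeIn x Phi S w) fun i => ENNReal.ofReal (p.rate x Phi s v k i w)
  simp_rw [h1]
  rw [lintegral_tsum fun i => ((hN.measurable_rate hp hv k i).ennreal_ofReal.indicator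
    (hN.measurableSet_activeIn hS i)).aemeasurable]
  exact tsum_congr fun i => lintegral_indicator (hN.measurableSet_activeIn hS i) _

theorem rateBound_le_avgRate [IsProbabilityMeasure P] (hN : IsNetwork x Phi s p.lam p.sigmaS P)
    (hp : p.Positive) {v : Plane} (hv : v ≠ 0) (k : Fin K) {S : Set Plane} (hS : MeasurableSet S)
    (hS0 : volume S ≠ 0) (hS1 : volume S ≠ ∞) :
    p.rateBound p.shadowMoment v ≤ p.avgRate x Phi s P v k S := by
  rcases eq_or_ne (p.pairIntegral v) ⊤ with htop | htop
  · rw [Params.rateBound_of_pairIntegral_eq_top hp _ htop]; exact bot_le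
  have hm : 0 < p.shadowMoment := Real.exp_pos _
  have hz := Params.zeta1_pos hp
  have hg := Params.gain_pos hp
  have hn : 0 < p.sigmaN ^ 2 := by have := hp.sigmaN; positivity
  set J := p.meanInterference v p.shadowMoment with hJ
  have hJ0 : 0 ≤ J := Params.meanInterference_nonneg hp v hm.le
  rw [Params.rateBound_eq_lintegral_shadowLaw hp hm htop, Params.avgRate,
    hN.lintegral_encard_activeIn hS, hN.lintegral_tsum_rate hp hv k hS]
  let D (i : ℕ) : Set Ω := {w | x i w ∈ S ∧ IsActive x Phi p.δ w i}
  set N := ∑' i, P (D i) with hNdef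
  have hNge : ENNReal.ofReal p.zeta1 * volume S ≤ N :=
    hN.isMarkedPoisson.mean_active_ge hp.lam hp.δ hS hS1
  have hN0 : N ≠ 0 := by
    intro h
    rw [h, nonpos_iff_eq_zero, mul_eq_zero] at hNge
    rcases hNge with h | h
    · exact absurd (ENNReal.ofReal_eq_zero.1 h) (not_le.2 hz)
    · exact hS0 h
  have hNtop : N ≠ ⊤ := by
    have h1 := hN.isMarkedPoisson.mean_points hp.lam.le hS hS1
    refine ne_top_of_le_ne_top (ENNReal.ofReal_ne_top (r := p.lam * volume.real S)) ?_
    rw [← h1]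
    exact ENNReal.tsum_le_tsum fun i => measure_mono fun w hw => hw.1
  let f : ℝ → ℝ≥0∞ := fun t =>
    ENNReal.ofReal (Real.logb 2 (1 + p.signalPower v t / (J + p.sigmaN ^ 2)))
  let G : ℝ → ℝ≥0∞ := fun t => ENNReal.ofReal (rateSlope (p.signalPower v t) J (p.sigmaN ^ 2))
  have hsm := measurable_signalPower p v
  have hf : Measurable f := by
    simp only [f, Real.logb]
    fun_prop
  have hG : Measurable G := by
    simp only [G, rateSlope]
    fun_prop
  -- The slope is bounded uniformly in the shadowing. Finiteness is needed to cancel the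
  -- interference terms at the end.
  have hGtop : ∫⁻ t, G t ∂p.shadowLaw ≠ ⊤ := by
    refine ne_top_of_le_ne_top
      (ENNReal.ofReal_ne_top (r := 1 / (J + p.sigmaN ^ 2) / Real.log 2)) ?_
    calc ∫⁻ t, G t ∂p.shadowLaw
        ≤ ∫⁻ _, ENNReal.ofReal (1 / (J + p.sigmaN ^ 2) / Real.log 2) ∂p.shadowLaw :=
          lintegral_mono fun t => ENNReal.ofReal_le_ofReal
            (rateSlope_le (Params.signalPower_pos hp hv t) hJ0 hn)
      _ = _ := by simp
  set C := ∫⁻ t, G t ∂p.shadowLaw with hC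
  change ∫⁻ t, f t ∂p.shadowLaw ≤ (∑' i, ∫⁻ w in D i, ENNReal.ofReal (p.rate x Phi s v k i w) ∂P) / N
  rw [ENNReal.le_div_iff_mul_le (Or.inl hN0) (Or.inl hNtop)]
  -- By the definition of `J`, gain times shadowing moment times pair integral equals ζ⁽¹⁾ `J`; the
  -- lower bound on `N` then absorbs ζ⁽¹⁾ `volume S`.
  have hint : ∑' i, ∫⁻ w in D i, G (s i k i w) * p.interference x Phi s v k i w ∂P ≤
      N * (C * ENNReal.ofReal J) := by
    refine (hN.tsum_setLIntegral_slope_mul_interference_le hp v k hS hG).trans ?_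
    have e1 : ENNReal.ofReal p.gain * ENNReal.ofReal p.shadowMoment * p.pairIntegral v =
        ENNReal.ofReal p.zeta1 * ENNReal.ofReal J := by
      rw [← ENNReal.ofReal_toReal htop, ← ENNReal.ofReal_mul hg.le, ← ENNReal.ofReal_mul (by positivity),
        ← ENNReal.ofReal_mul hz.le, hJ, Params.meanInterference]
      congr 1
      field_simp
    calc _ = (ENNReal.ofReal p.gain * ENNReal.ofReal p.shadowMoment * p.pairIntegral v) *
          (C * volume S) := by ring
      _ = (ENNReal.ofReal p.zeta1 * volume S) * (C * ENNReal.ofReal J) := by rw [e1]; ring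
      _ ≤ N * (C * ENNReal.ofReal J) := mul_le_mul_left hNge _
  -- Tangent inequality at level `J`, integrated over each event that cell `i` is active in `S` and
  -- added over `i`.
  have htan : N * (∫⁻ t, f t ∂p.shadowLaw) + N * (C * ENNReal.ofReal J) ≤
      (∑' i, ∫⁻ w in D i, ENNReal.ofReal (p.rate x Phi s v k i w) ∂P) +
        ∑' i, ∫⁻ w in D i, G (s i k i w) * p.interference x Phi s v k i w ∂P := by
    rw [← mul_add, hNdef, ← ENNReal.tsum_mul_right, ← ENNReal.tsum_add]
    refine ENNReal.tsum_le_tsum fun i => ?_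
    have hfG : Measurable fun t => f t + G t * ENNReal.ofReal J := hf.add (hG.mul_const _)
    rw [hC, ← lintegral_mul_const _ hG, ← lintegral_add_left hf,
      ← hN.setLIntegral_active_shadow k i hS hfG,
      ← lintegral_add_left (hN.measurable_rate hp hv k i).ennreal_ofReal]
    refine lintegral_mono fun w => ?_
    have := rate_tangent_le (Params.signalPower_pos hp hv (s i k i w)) hJ0 hn
      (p.interference x Phi s v k i w)
    rw [← Params.signal_eq hp hv] at this
    exact this
  have hfin : N * (C * ENNReal.ofReal J) ≠ ⊤ :=
    ENNReal.mul_ne_top hNtop (ENNReal.mul_ne_top hGtop ENNReal.ofReal_ne_top)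
  rw [mul_comm]
  exact ENNReal.le_of_add_le_add_right hfin (htan.trans (add_le_add_right hint _))

end IsNetwork

end

theorem theorem1 {Ω : Type*} [MeasurableSpace Ω] (P : Measure Ω) [IsProbabilityMeasure P]
    (p : Params) (hp : p.Positive) {K : ℕ}
    (x : ℕ → Ω → Plane) (Phi : ℕ → Ω → ℝ) (s : ℕ → Fin K → ℕ → Ω → ℝ)
    (hN : IsNetwork x Phi s p.lam p.sigmaS P)
    (k : Fin K) (v : Plane) (hv : v ≠ 0)
    (S : Set Plane) (hS : MeasurableSet S) (hS0 : volume S ≠ 0) (hS1 : volume S ≠ ∞) :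
    p.rateBound (Real.exp (2 * p.sigmaS ^ 2 / p.b ^ 2)) v ≤ p.avgRate x Phi s P v k S ∧
    (1 ≤ p.b →
      p.rateBound (Real.exp (2 * p.sigmaS ^ 2)) v ≤ p.avgRate x Phi s P v k S) := by
  have h := hN.rateBound_le_avgRate hp hv k hS hS0 hS1
  refine ⟨h, fun hb => (Params.rateBound_antitone hp (Real.exp_pos _) ?_ v).trans h⟩
  exact Real.exp_le_exp.2 (div_le_self (by positivity) (one_le_pow₀ hb))
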